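/- Let $M$ be a compact Riemannian manifold (smooth, without boundary) with Levi-Civita connection $\nabla$, curvature $R(X,Y)Z=\nabla_X\nabla_YZ-\nabla_Y\nabla_XZ-\nabla_{[X,Y]}Z$ and Riemannian distance $d(\cdot,\cdot)$. A geodesic $\sigma:[0,1]\to M$ is called \emph{short} if its length is less than the injectivity radius of $M$. A \emph{tangent field} along $\sigma$ is a vector field $\psi_t\in T_{\sigma_t}M$ of the form $\psi_t=\partial_s H(s,t)|_{s=0}$, where $H:(-\varepsilon,\varepsilon)\times[0,1]\to M$ is smooth, each $H(s,\cdot)$ is a geodesic, and $H(0,\cdot)=\sigma$. Let $\tilde\psi_t\in T_{\sigma_0}M$ denote the parallel translate of $\psi_t$ from $\sigma_t$ to $\sigma_0$ along $\sigma$, and write $\dot\sigma_t=\partial_t\sigma_t$. Then for every short geodesic $\sigma:[0,1]\to M$ and every tangent field $\psi$ along $\sigma$, with $d=d(\sigma_0,\sigma_1)$ and $|\psi|=\max(|\psi_0|,|\psi_1|)$, one has for all $t\in[0,1]$ $$\tilde\psi_t = t\,\tilde\psi_1+(1-t)\,\psi_0+\frac{t^3-t}{6}\,R(\dot\sigma_0,\tilde\psi_1)\,\dot\sigma_0-\frac{t^3-3t^2+2t}{6}\,R(\dot\sigma_0,\psi_0)\,\dot\sigma_0+O(d^3)\,|\psi|,$$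 where $R$ is evaluated at $\sigma_0$. Here $O(d^3)$ is meant as $d\to0$, uniformly: there are constants $C>0$ and $\delta>0$, depending only on the Riemannian manifold $M$, such that, whenever $d\le\delta$, the norm of the difference of the two sides without the error term is at most $C\,d^3\,|\psi|$ for all $t\in[0,1]$. -/

import Mathlib

open Set Manifold Bundle
open scoped ContDiff ENNReal Topology

noncomputable section

namespace ShortGeodesic

section Coordinates

variable {E : Type*} [NormedAddCommGroup E] [NormedSpace ℝ E]

/-- For a metric `g` given in coordinates `y`, the linear form
`w ↦ 1/2 (∂_u g(v, w) + ∂_v g(u, w) - ∂_w g(u, v))` at `y`, i.e. the Christoffel symbols of the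
first kind `Γ_{μν,η} = 1/2 (g_{μη,ν} + g_{νη,μ} - g_{μν,η})`. -/
def christoffelFirst (g : E → E →L[ℝ] E →L[ℝ] ℝ) (y u v : E) : E →L[ℝ] ℝ :=
  (1 / 2 : ℝ) • (fderiv ℝ g y u v + fderiv ℝ g y v u - ((fderiv ℝ g y).flip u).flip v)

/-- The Christoffel symbols of the Levi-Civita connection of `g`, as the
bilinear map `(u, v) ↦ ∑ Γ^γ_{μν}(y) u^μ v^ν ∂_γ`: the index of `christoffelFirst` is raised with
the inverse of the metric. -/
def christoffel (g : E → E →L[ℝ] E →L[ℝ] ℝ) (y u v : E) : E :=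
  (g y).inverse (christoffelFirst g y u v)

/-- The curvature in coordinates of the Levi-Civita connection of `g`:
`R(u, v) w = (∂_u Γ)(v, w) - (∂_v Γ)(u, w) + Γ(u, Γ(v, w)) - Γ(v, Γ(u, w))`. -/
def coordCurvature (g : E → E →L[ℝ] E →L[ℝ] ℝ) (y u v w : E) : E :=
  fderiv ℝ (fun z ↦ christoffel g z v w) y u - fderiv ℝ (fun z ↦ christoffel g z u w) y v
    + christoffel g y u (christoffel g y v w) - christoffel g y v (christoffel g y u w)

end Coordinates

variable {E : Type*} [NormedAddCommGroup E] [NormedSpace ℝ E]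
  {M : Type*} [TopologicalSpace M] [ChartedSpace E M] [IsManifold 𝓘(ℝ, E) ∞ M]

/-- The differential at `x` of the coordinate chart centred at `p`: it sends a tangent vector at `x`
to the vector of its coordinates (for `x` in the domain of that chart). -/
def toChart (p x : M) : TangentSpace 𝓘(ℝ, E) x →L[ℝ] E :=
  (trivializationAt E (TangentSpace 𝓘(ℝ, E)) p).continuousLinearMapAt ℝ x

/-- The inverse of `toChart p x`: the tangent vector at `x` with given coordinates in the chart
centred at `p`. -/
def ofChart (p x : M) : E →L[ℝ] TangentSpace 𝓘(ℝ, E) x :=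
  (trivializationAt E (TangentSpace 𝓘(ℝ, E)) p).symmL ℝ x

/-- `toChart` is the manifold derivative of the chart. -/
lemma toChart_eq_mfderiv {p x : M} (hx : x ∈ (chartAt E p).source) :
    toChart p x = mfderiv 𝓘(ℝ, E) 𝓘(ℝ, E) (extChartAt 𝓘(ℝ, E) p) x :=
  TangentBundle.continuousLinearMapAt_trivializationAt hx

lemma toChart_ofChart {p x : M} (hx : x ∈ (chartAt E p).source) (e : E) :
    toChart p x (ofChart p x e) = e :=
  (trivializationAt E (TangentSpace 𝓘(ℝ, E)) p).continuousLinearMapAt_symmL (R := ℝ)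
    (by simpa using hx) e

variable [RiemannianBundle (fun x : M ↦ TangentSpace 𝓘(ℝ, E) x)]

/-- The metric `g` in the chart centred at `p`, as a function of the coordinates `y`:
the bilinear form `(u, v) ↦ ∑ g_{μν}(y) u^μ v^ν`. -/
def chartMetric (p : M) (y : E) : E →L[ℝ] E →L[ℝ] ℝ :=
  (innerSL ℝ (E := TangentSpace 𝓘(ℝ, E) ((extChartAt 𝓘(ℝ, E) p).symm y))).bilinearComp
    (ofChart p ((extChartAt 𝓘(ℝ, E) p).symm y)) (ofChart p ((extChartAt 𝓘(ℝ, E) p).symm y))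

/-- The curvature operator `R(u, v) · w` at `x`, with
`R(X, Y) Z = ∇_X ∇_Y Z - ∇_Y ∇_X Z - ∇_{[X, Y]} Z`, computed in the chart centred at `x`. -/
def curvature (x : M) (u v w : TangentSpace 𝓘(ℝ, E) x) : TangentSpace 𝓘(ℝ, E) x :=
  ofChart x x (coordCurvature (chartMetric x) (extChartAt 𝓘(ℝ, E) x x)
    (toChart x x u) (toChart x x v) (toChart x x w))

/-- The velocity `∂_t c` of a curve defined on `[0, 1]` (one-sided at the endpoints). -/
def velocity (c : ℝ → M) (t : ℝ) : TangentSpace 𝓘(ℝ, E) (c t) :=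
  mfderivWithin 𝓘(ℝ, ℝ) 𝓘(ℝ, E) c (Icc 0 1) t (1 : ℝ)

/-- The vector field `V` along the curve `c : [0, 1] → M` is parallel for the Levi-Civita
connection: in coordinates, `dV/dt + Γ(dc/dt, V) = 0`. -/
def IsParallel (c : ℝ → M) (V : ∀ t, TangentSpace 𝓘(ℝ, E) (c t)) : Prop :=
  ∀ t ∈ Icc (0 : ℝ) 1, ∀ p : M, c t ∈ (chartAt E p).source →
    HasDerivWithinAt (fun τ ↦ toChart p (c τ) (V τ))
      (-christoffel (chartMetric p) (extChartAt 𝓘(ℝ, E) p (c t))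
        (toChart p (c t) (velocity c t)) (toChart p (c t) (V t)))
      (Icc 0 1) t

open Classical in
/-- Parallel translation of the tangent vector `v` at `c t` to the starting point `c 0`, along the
curve `c : [0, 1] → M`: the value at `0` of the parallel field along `c` whose value at `t`
is `v`. -/
def parallelTranslate (c : ℝ → M) (t : ℝ) (v : TangentSpace 𝓘(ℝ, E) (c t)) :
    TangentSpace 𝓘(ℝ, E) (c 0) :=
  if h : ∃ V : ∀ τ, TangentSpace 𝓘(ℝ, E) (c τ), IsParallel c V ∧ V t = v then h.choose 0 else 0

variable (E) in
/-- `c : [0, 1] → M` is a geodesic: it is smooth and its velocity is parallel along it.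
Only the restriction of `c` to `[0, 1]` matters. -/
def IsGeodesic (c : ℝ → M) : Prop :=
  ContMDiffOn 𝓘(ℝ, ℝ) 𝓘(ℝ, E) ∞ c (Icc 0 1) ∧ IsParallel c (velocity (E := E) c)

variable (E M) in
/-- The injectivity radius: the supremum of all `r` such that every geodesic of length
less than `r` is minimizing and is the only geodesic of length less than `r`
between its endpoints. -/
def injRadius : ℝ≥0∞ :=
  sSup {r : ℝ≥0∞ | ∀ c : ℝ → M, IsGeodesic E c → pathELength 𝓘(ℝ, E) c 0 1 < r →
    pathELength 𝓘(ℝ, E) c 0 1 = riemannianEDist 𝓘(ℝ, E) (c 0) (c 1) ∧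
    ∀ c' : ℝ → M, IsGeodesic E c' → pathELength 𝓘(ℝ, E) c' 0 1 < r →
      c' 0 = c 0 → c' 1 = c 1 → EqOn c' c (Icc 0 1)}

variable (E) in
/-- A short geodesic: a geodesic of length less than the injectivity radius. -/
def IsShortGeodesic (c : ℝ → M) : Prop :=
  IsGeodesic E c ∧ pathELength 𝓘(ℝ, E) c 0 1 < injRadius E M

/-- `ψ` is a tangent field along `c` : it is tangent at `c` to the space of geodesics, i.e.
`ψ t = ∂_s H(s, t)` at `s = 0` for a smooth one-parameter family `H(s, ·)` of geodesics on `[0, 1]`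
with `H(0, ·) = c`. (The equation in the tangent bundle also says that `H(0, t) = c t`.) -/
def IsTangentField (c : ℝ → M) (ψ : ∀ t, TangentSpace 𝓘(ℝ, E) (c t)) : Prop :=
  ∃ ε > (0 : ℝ), ∃ H : ℝ × ℝ → M,
    ContMDiffOn 𝓘(ℝ, ℝ × ℝ) 𝓘(ℝ, E) ∞ H (Ioo (-ε) ε ×ˢ Icc 0 1) ∧
    (∀ s ∈ Ioo (-ε) ε, IsGeodesic E (fun t ↦ H (s, t))) ∧
    ∀ t ∈ Icc (0 : ℝ) 1, (⟨c t, ψ t⟩ : TangentBundle 𝓘(ℝ, E) M) =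
      ⟨H (0, t), mfderiv 𝓘(ℝ, ℝ) 𝓘(ℝ, E) (fun s ↦ H (s, t)) 0 (1 : ℝ)⟩

end ShortGeodesic

end

/-!
Along a geodesic `σ`, a tangent field `ψ` satisfies the Jacobi equation, so that its parallel
translate `u t = ψ̃ t` to `σ 0` satisfies `u'' = R_t(σ̇ 0, u) σ̇ 0`, where `R_t` is the parallel
translate to `σ 0` of the curvature at `σ t`. When `σ` has length `d`, the right-hand side is
`O(d²) |u|`, and it differs from `B u = R(σ̇ 0, u) σ̇ 0` by `O(d³) |u|`, because `R_t` differs from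
the curvature at `σ 0` by `O(d)`. A function vanishing at `0` and `1` is bounded by its second
derivative; hence `u` is the linear interpolation `ℓ` of its boundary values up to `O(d²)`, then
`u''` is `B ℓ` up to `O(d³)`, and integrating `B ℓ` twice gives the cubic polynomials of the
expansion. This boundary value argument is `norm_sub_cubic_le`.

Everything is carried out in a single chart. Parallel translation is given by the propagator of a
linear differential equation (`exists_propagator`, `toChart_parallelTranslate`), and the Jacobi
equation follows from the linearized geodesic equation (`exists_linearized_geodesic`,
`hasDerivWithinAt_covDeriv`); the resulting estimate is `norm_jacobi_sub_cubic_le`. Parallel fields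
are required to solve their equation in all charts, and the curvature at a point is defined in the
chart centred at this point, so the transformation laws of the Christoffel symbols and of the
curvature are needed (`fderiv_christoffel`, `fderiv_coordCurvature`).

The constants are uniform by compactness. Around each point there are bounds for the geometry in
the chart (`exists_local_bounds`), a sufficiently short curve starting near the point stays in the
region where they hold (`exists_nhds_forall_mem_of_pathELength_lt`), and finitely many such
neighbourhoods cover the manifold. The definition of the injectivity radius is used only to identify
the length of a short geodesic with the distance `d` between its endpoints; since the speed of a
geodesic is constant, `d` is also the norm of its initial velocity.
-/

noncomputable section

-- needed to find the norms on spaces of bilinear and trilinear maps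
set_option maxSynthPendingDepth 3

namespace ShortGeodesic

/-! ### Metrics, Christoffel symbols and curvature in coordinates -/

section CoordinateMetric

variable {E : Type*} [NormedAddCommGroup E] [NormedSpace ℝ E]

/-- `g` is a smooth Riemannian metric on the open subset `U` of the vector space `E`. -/
structure IsMetricOn (g : E → E →L[ℝ] E →L[ℝ] ℝ) (U : Set E) : Prop where
  isOpen : IsOpen U
  contDiffOn : ContDiffOn ℝ ∞ g U
  symm : ∀ y ∈ U, ∀ u v, g y u v = g y v u
  pos : ∀ y ∈ U, ∀ u, u ≠ 0 → 0 < g y u u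

lemma two_le_infty : minSmoothness ℝ 2 ≤ (∞ : WithTop ℕ∞) := by
  rw [minSmoothness_of_isRCLikeNormedField]
  exact WithTop.coe_le_coe.2 le_top

lemma christoffelFirst_apply (g : E → E →L[ℝ] E →L[ℝ] ℝ) (y u v w : E) :
    christoffelFirst g y u v w =
      (1 / 2 : ℝ) * (fderiv ℝ g y u v w + fderiv ℝ g y v u w - fderiv ℝ g y w u v) := by
  simp [christoffelFirst]

/-- The curvature `R(u, v) w` of the connection with Christoffel symbols `Γ`, bundled as a continuous
trilinear map. -/
def curvatureCLM (Γ : E → E →L[ℝ] E →L[ℝ] E) (y : E) : E →L[ℝ] E →L[ℝ] E →L[ℝ] E :=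
  fderiv ℝ Γ y - (fderiv ℝ Γ y).flip
    + (ContinuousLinearMap.compL ℝ E E E).bilinearComp (Γ y) (Γ y)
    - ((ContinuousLinearMap.compL ℝ E E E).bilinearComp (Γ y) (Γ y)).flip

lemma curvatureCLM_apply (Γ : E → E →L[ℝ] E →L[ℝ] E) (y u v w : E) :
    curvatureCLM Γ y u v w = fderiv ℝ Γ y u v w - fderiv ℝ Γ y v u w
      + Γ y u (Γ y v w) - Γ y v (Γ y u w) := by
  simp [curvatureCLM]

variable [FiniteDimensional ℝ E]

/-- The Christoffel symbols of `g` at `y`, bundled as a continuous bilinear map. -/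
def christoffelCLM (g : E → E →L[ℝ] E →L[ℝ] ℝ) (y : E) : E →L[ℝ] E →L[ℝ] E :=
  LinearMap.toContinuousLinearMap
    { toFun := fun u ↦ LinearMap.toContinuousLinearMap
        { toFun := fun v ↦ christoffel g y u v
          map_add' := fun v v' ↦ by
            have : christoffelFirst g y u (v + v')
                = christoffelFirst g y u v + christoffelFirst g y u v' := by
              ext w; simp only [christoffelFirst_apply, map_add, add_apply]; ring
            simp only [christoffel, this, map_add]
          map_smul' := fun c v ↦ by
            have : christoffelFirst g y u (c • v) = c • christoffelFirst g y u v := by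
              ext w; simp only [christoffelFirst_apply, map_smul, smul_apply, smul_eq_mul]; ring
            simp only [christoffel, this, map_smul, RingHom.id_apply] }
      map_add' := fun u u' ↦ by
        ext v
        have : christoffelFirst g y (u + u') v
            = christoffelFirst g y u v + christoffelFirst g y u' v := by
          ext w; simp only [christoffelFirst_apply, map_add, add_apply]; ring
        simp [christoffel, this, map_add]
      map_smul' := fun c u ↦ by
        ext v
        have : christoffelFirst g y (c • u) v = c • christoffelFirst g y u v := by
          ext w; simp only [christoffelFirst_apply, map_smul, smul_apply, smul_eq_mul]; ring
        simp [christoffel, this, map_smul] }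

@[simp]
lemma christoffelCLM_apply (g : E → E →L[ℝ] E →L[ℝ] ℝ) (y u v : E) :
    christoffelCLM g y u v = christoffel g y u v := rfl

variable {g : E → E →L[ℝ] E →L[ℝ] ℝ} {U : Set E}

lemma IsMetricOn.isInvertible (hg : IsMetricOn g U) {y : E} (hy : y ∈ U) :
    (g y).IsInvertible := by
  have hinj : Function.Injective (g y) := by
    rw [injective_iff_map_eq_zero]
    intro u hu
    by_contra h
    have := hg.pos y hy u h
    simp [hu] at this
  have hdim : Module.finrank ℝ E = Module.finrank ℝ (E →L[ℝ] ℝ) := by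
    rw [← (LinearMap.toContinuousLinearMap (𝕜 := ℝ) (E := E) (F' := ℝ)).finrank_eq]
    exact (Subspace.dual_finrank_eq (K := ℝ) (V := E)).symm
  let e := LinearEquiv.ofInjectiveOfFinrankEq (g y : E →ₗ[ℝ] (E →L[ℝ] ℝ)) hinj hdim
  exact ⟨e.toContinuousLinearEquiv, by ext; rfl⟩

lemma IsMetricOn.apply_christoffel (hg : IsMetricOn g U) {y : E} (hy : y ∈ U) (u v w : E) :
    g y (christoffel g y u v) w =
      (1 / 2 : ℝ) * (fderiv ℝ g y u v w + fderiv ℝ g y v u w - fderiv ℝ g y w u v) := by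
  rw [← christoffelFirst_apply, christoffel]
  obtain ⟨e, he⟩ := hg.isInvertible hy
  rw [← he, ContinuousLinearMap.inverse_equiv]
  simp

omit [FiniteDimensional ℝ E] in
lemma IsMetricOn.contDiffAt (hg : IsMetricOn g U) {y : E} (hy : y ∈ U) : ContDiffAt ℝ ∞ g y :=
  hg.contDiffOn.contDiffAt (hg.isOpen.mem_nhds hy)

omit [FiniteDimensional ℝ E] in
lemma IsMetricOn.differentiableAt (hg : IsMetricOn g U) {y : E} (hy : y ∈ U) :
    DifferentiableAt ℝ g y :=
  (hg.contDiffAt hy).differentiableAt (by simp)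

omit [FiniteDimensional ℝ E] in
lemma IsMetricOn.fderiv_symm (hg : IsMetricOn g U) {y : E} (hy : y ∈ U) (u v w : E) :
    fderiv ℝ g y u v w = fderiv ℝ g y u w v := by
  have h1 (a b : E) : HasFDerivAt (fun z ↦ g z a b)
      (((fderiv ℝ g y).flip a).flip b) y := by
    have := (((hg.differentiableAt hy).hasFDerivAt.clm_apply (hasFDerivAt_const a y)).clm_apply
      (hasFDerivAt_const b y))
    refine this.congr_fderiv ?_
    ext; simp
  have h2 : (fun z ↦ g z v w) =ᶠ[𝓝 y] fun z ↦ g z w v := by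
    filter_upwards [hg.isOpen.mem_nhds hy] with z hz using hg.symm z hz v w
  have := (h1 v w).unique ((h1 w v).congr_of_eventuallyEq h2)
  simpa using congr($this u)

omit [FiniteDimensional ℝ E] in
lemma IsMetricOn.christoffel_symm (hg : IsMetricOn g U) {y : E} (hy : y ∈ U) (u v : E) :
    christoffel g y u v = christoffel g y v u := by
  have : christoffelFirst g y u v = christoffelFirst g y v u := by
    ext w
    rw [christoffelFirst_apply, christoffelFirst_apply, hg.fderiv_symm hy w u v]
    ring
  rw [christoffel, christoffel, this]

lemma IsMetricOn.contDiffOn_christoffelCLM (hg : IsMetricOn g U) :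
    ContDiffOn ℝ ∞ (christoffelCLM g) U := by
  rw [contDiffOn_clm_apply]
  intro u
  rw [contDiffOn_clm_apply]
  intro v
  have hD : ContDiffOn ℝ ∞ (fderiv ℝ g) U :=
    hg.contDiffOn.fderiv_of_isOpen hg.isOpen (by simp)
  have hF : ContDiffOn ℝ ∞ (fun y ↦ christoffelFirst g y u v) U := by
    rw [contDiffOn_clm_apply]
    intro w
    simp only [christoffelFirst_apply]
    have (a b c : E) : ContDiffOn ℝ ∞ (fun y ↦ fderiv ℝ g y a b c) U :=
      ((hD.clm_apply contDiffOn_const).clm_apply contDiffOn_const).clm_apply contDiffOn_const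
    exact contDiffOn_const.mul (((this _ _ _).add (this _ _ _)).sub (this _ _ _))
  have hI : ContDiffOn ℝ ∞ (fun y ↦ (g y).inverse) U := by
    intro y hy
    obtain ⟨e, he⟩ := hg.isInvertible hy
    have h1 : ContDiffAt ℝ ∞ ContinuousLinearMap.inverse (g y) := by
      rw [← he]; exact contDiffAt_map_inverse e
    exact (h1.comp y (hg.contDiffAt hy)).contDiffWithinAt
  exact hI.clm_apply hF

lemma IsMetricOn.contDiffAt_christoffelCLM (hg : IsMetricOn g U) {y : E} (hy : y ∈ U) :
    ContDiffAt ℝ ∞ (christoffelCLM g) y :=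
  hg.contDiffOn_christoffelCLM.contDiffAt (hg.isOpen.mem_nhds hy)

lemma IsMetricOn.hasFDerivAt_christoffelCLM (hg : IsMetricOn g U) {y : E} (hy : y ∈ U) :
    HasFDerivAt (christoffelCLM g) (fderiv ℝ (christoffelCLM g) y) y :=
  ((hg.contDiffAt_christoffelCLM hy).differentiableAt (by simp)).hasFDerivAt

lemma IsMetricOn.coordCurvature_eq (hg : IsMetricOn g U) {y : E} (hy : y ∈ U) (u v w : E) :
    coordCurvature g y u v w = curvatureCLM (christoffelCLM g) y u v w := by
  have (a b c : E) : fderiv ℝ (fun z ↦ christoffel g z a b) y c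
      = fderiv ℝ (christoffelCLM g) y c a b := by
    have := ((hg.hasFDerivAt_christoffelCLM hy).clm_apply (hasFDerivAt_const a y)).clm_apply
      (hasFDerivAt_const b y)
    simpa using congr($(this.fderiv) c)
  rw [coordCurvature, curvatureCLM_apply, this, this]
  rfl

lemma contDiffOn_curvatureCLM {Γ : E → E →L[ℝ] E →L[ℝ] E} (hU : IsOpen U)
    (hΓ : ContDiffOn ℝ ∞ Γ U) : ContDiffOn ℝ ∞ (curvatureCLM Γ) U := by
  rw [contDiffOn_clm_apply]
  intro u
  rw [contDiffOn_clm_apply]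
  intro v
  rw [contDiffOn_clm_apply]
  intro w
  simp only [curvatureCLM_apply]
  have hD : ContDiffOn ℝ ∞ (fderiv ℝ Γ) U := hΓ.fderiv_of_isOpen hU (by simp)
  have h1 (a b c : E) : ContDiffOn ℝ ∞ (fun y ↦ fderiv ℝ Γ y a b c) U :=
    ((hD.clm_apply contDiffOn_const).clm_apply contDiffOn_const).clm_apply contDiffOn_const
  have h2 (a b c : E) : ContDiffOn ℝ ∞ (fun y ↦ Γ y a (Γ y b c)) U :=
    (hΓ.clm_apply contDiffOn_const).clm_apply
      ((hΓ.clm_apply contDiffOn_const).clm_apply contDiffOn_const)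
  exact (((h1 _ _ _).sub (h1 _ _ _)).add (h2 _ _ _)).sub (h2 _ _ _)

/-- A field that is parallel in coordinates along a curve has constant length. -/
lemma IsMetricOn.hasDerivWithinAt_parallel (hg : IsMetricOn g U) {s : Set ℝ} {x V : ℝ → E}
    {t : ℝ} {v : E} (hx : x t ∈ U) (hx' : HasDerivWithinAt x v s t)
    (hV : HasDerivWithinAt V (-christoffel g (x t) v (V t)) s t) :
    HasDerivWithinAt (fun τ ↦ g (x τ) (V τ) (V τ)) 0 s t := by
  have h1 : HasDerivWithinAt (fun τ ↦ g (x τ)) (fderiv ℝ g (x t) v) s t :=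
    (hg.differentiableAt hx).hasFDerivAt.comp_hasDerivWithinAt t hx'
  have h2 := (h1.clm_apply hV).clm_apply hV
  refine h2.congr_deriv ?_
  have h3 := hg.apply_christoffel hx v (V t) (V t)
  have h4 := hg.symm _ hx (V t) (christoffel g (x t) v (V t))
  simp only [map_neg, add_apply, neg_apply]
  linarith

variable {h : E → E →L[ℝ] E →L[ℝ] ℝ} {W : Set E} {φ : E → E}

omit [FiniteDimensional ℝ E] in
/-- The derivative of the relation between a metric and its expression in other coordinates. -/
lemma fderiv_pullback_metric (hU : IsOpen U) (hh : IsMetricOn h W)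
    (hφ : ContDiffOn ℝ ∞ φ U) (hφW : MapsTo φ U W)
    (hgh : ∀ y ∈ U, ∀ u v, g y u v = h (φ y) (fderiv ℝ φ y u) (fderiv ℝ φ y v))
    (hg : IsMetricOn g U) {y : E} (hy : y ∈ U) (a b c : E) :
    fderiv ℝ g y a b c =
      fderiv ℝ h (φ y) (fderiv ℝ φ y a) (fderiv ℝ φ y b) (fderiv ℝ φ y c)
      + h (φ y) (fderiv ℝ (fderiv ℝ φ) y a b) (fderiv ℝ φ y c)
      + h (φ y) (fderiv ℝ φ y b) (fderiv ℝ (fderiv ℝ φ) y a c) := by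
  have h1 : HasFDerivAt φ (fderiv ℝ φ y) y :=
    ((hφ.contDiffAt (hU.mem_nhds hy)).differentiableAt (by simp)).hasFDerivAt
  have h2 : HasFDerivAt (fderiv ℝ φ) (fderiv ℝ (fderiv ℝ φ) y) y :=
    (((hφ.fderiv_of_isOpen (m := ∞) hU (by simp)).contDiffAt
      (hU.mem_nhds hy)).differentiableAt (by simp)).hasFDerivAt
  have h3 := ((hh.differentiableAt (hφW hy)).hasFDerivAt.comp y h1)
  have h4 (e : E) := h2.clm_apply (hasFDerivAt_const e y)
  have h5 := (h3.clm_apply (h4 b)).clm_apply (h4 c)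
  have h6 := ((hg.differentiableAt hy).hasFDerivAt.clm_apply (hasFDerivAt_const b y)).clm_apply
      (hasFDerivAt_const c y)
  have h7 : (fun z ↦ g z b c) =ᶠ[𝓝 y]
      fun z ↦ h (φ z) (fderiv ℝ φ z b) (fderiv ℝ φ z c) := by
    filter_upwards [hU.mem_nhds hy] with z hz using hgh z hz b c
  have := congr($(h6.unique (h5.congr_of_eventuallyEq h7)) a)
  simp at this
  linarith

/-- The transformation law of the Christoffel symbols under a change of coordinates `φ`. -/
lemma fderiv_christoffel (hg : IsMetricOn g U) (hh : IsMetricOn h W)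
    (hφ : ContDiffOn ℝ ∞ φ U) (hφW : MapsTo φ U W)
    (hgh : ∀ y ∈ U, ∀ u v, g y u v = h (φ y) (fderiv ℝ φ y u) (fderiv ℝ φ y v))
    {y : E} (hy : y ∈ U) (hs : Function.Surjective (fderiv ℝ φ y)) (u v : E) :
    fderiv ℝ φ y (christoffel g y u v) = fderiv ℝ (fderiv ℝ φ) y u v
      + christoffel h (φ y) (fderiv ℝ φ y u) (fderiv ℝ φ y v) := by
  -- the metric `h` is definite, so it suffices to pair the difference `z` of the two sides with `z`
  rw [← sub_eq_zero]
  by_contra hne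
  have hpos := hh.pos _ (hφW hy) _ hne
  refine hpos.ne' ?_
  set z := fderiv ℝ φ y (christoffel g y u v) - (fderiv ℝ (fderiv ℝ φ) y u v
      + christoffel h (φ y) (fderiv ℝ φ y u) (fderiv ℝ φ y v)) with hz
  obtain ⟨w, hw⟩ := hs z
  have e1 : h (φ y) z z = h (φ y) z (fderiv ℝ φ y w) := by rw [hw]
  rw [e1, hz, map_sub, map_add, sub_apply, add_apply, ← hgh y hy,
    hg.apply_christoffel hy, hh.apply_christoffel (hφW hy)]
  have hsymm (a b : E) : fderiv ℝ (fderiv ℝ φ) y a b = fderiv ℝ (fderiv ℝ φ) y b a :=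
    ((hφ.contDiffAt (hg.isOpen.mem_nhds hy)).isSymmSndFDerivAt two_le_infty).eq a b
  have key := fderiv_pullback_metric hg.isOpen hh hφ hφW hgh hg hy
  rw [key u v w, key v u w, key w u v, hsymm v u, hsymm w u, hsymm w v,
    hh.symm _ (hφW hy) (fderiv ℝ φ y u) (fderiv ℝ (fderiv ℝ φ) y v w),
    hh.symm _ (hφW hy) (fderiv ℝ φ y v) (fderiv ℝ (fderiv ℝ φ) y u w)]
  ring

/-- The equation of a parallel field along a curve is compatible with changes of coordinates. -/
lemma hasDerivWithinAt_parallel_map (hg : IsMetricOn g U) (hh : IsMetricOn h W)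
    (hφ : ContDiffOn ℝ ∞ φ U) (hφW : MapsTo φ U W)
    (hgh : ∀ y ∈ U, ∀ u v, g y u v = h (φ y) (fderiv ℝ φ y u) (fderiv ℝ φ y v))
    {s : Set ℝ} {x V : ℝ → E} {t : ℝ} {v : E} (hy : x t ∈ U)
    (hs : Function.Surjective (fderiv ℝ φ (x t))) (hx : HasDerivWithinAt x v s t)
    (hV : HasDerivWithinAt V (-christoffel g (x t) v (V t)) s t) :
    HasDerivWithinAt (fun τ ↦ fderiv ℝ φ (x τ) (V τ))
      (-christoffel h (φ (x t)) (fderiv ℝ φ (x t) v) (fderiv ℝ φ (x t) (V t))) s t := by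
  have h2 : HasFDerivAt (fderiv ℝ φ) (fderiv ℝ (fderiv ℝ φ) (x t)) (x t) :=
    (((hφ.fderiv_of_isOpen (m := ∞) hg.isOpen (by simp)).contDiffAt
      (hg.isOpen.mem_nhds hy)).differentiableAt (by simp)).hasFDerivAt
  refine ((h2.comp_hasDerivWithinAt t hx).clm_apply hV).congr_deriv ?_
  rw [map_neg, Function.comp_apply, fderiv_christoffel hg hh hφ hφW hgh hy hs]
  abel

/-- The curvature is a tensor: it is compatible with changes of coordinates. -/
lemma fderiv_coordCurvature (hg : IsMetricOn g U) (hh : IsMetricOn h W)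
    (hφ : ContDiffOn ℝ ∞ φ U) (hφW : MapsTo φ U W)
    (hgh : ∀ y ∈ U, ∀ u v, g y u v = h (φ y) (fderiv ℝ φ y u) (fderiv ℝ φ y v))
    (hs : ∀ y ∈ U, Function.Surjective (fderiv ℝ φ y)) {y : E} (hy : y ∈ U) (u v w : E) :
    fderiv ℝ φ y (coordCurvature g y u v w) =
      coordCurvature h (φ y) (fderiv ℝ φ y u) (fderiv ℝ φ y v) (fderiv ℝ φ y w) := by
  have hU := hg.isOpen.mem_nhds hy
  have hφ1 : ContDiffOn ℝ ∞ (fderiv ℝ φ) U := hφ.fderiv_of_isOpen hg.isOpen (by simp)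
  have hφ2 : ContDiffOn ℝ ∞ (fderiv ℝ (fderiv ℝ φ)) U :=
    hφ1.fderiv_of_isOpen hg.isOpen (by simp)
  have d0 : HasFDerivAt φ (fderiv ℝ φ y) y :=
    ((hφ.contDiffAt hU).differentiableAt (by simp)).hasFDerivAt
  have d1 : HasFDerivAt (fderiv ℝ φ) (fderiv ℝ (fderiv ℝ φ) y) y :=
    ((hφ1.contDiffAt hU).differentiableAt (by simp)).hasFDerivAt
  have d2 : HasFDerivAt (fderiv ℝ (fderiv ℝ φ)) (fderiv ℝ (fderiv ℝ (fderiv ℝ φ)) y) y :=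
    ((hφ2.contDiffAt hU).differentiableAt (by simp)).hasFDerivAt
  have dg := hg.hasFDerivAt_christoffelCLM hy
  have dh := (hh.hasFDerivAt_christoffelCLM (hφW hy)).comp y d0
  have c (e : E) := hasFDerivAt_const (𝕜 := ℝ) e y
  -- the derivative in the direction `a` of the transformation law of the Christoffel symbols
  have key (a b e : E) :
      fderiv ℝ (fderiv ℝ φ) y a (christoffelCLM g y b e)
        + fderiv ℝ φ y (fderiv ℝ (christoffelCLM g) y a b e)
      = fderiv ℝ (fderiv ℝ (fderiv ℝ φ)) y a b e
        + fderiv ℝ (christoffelCLM h) (φ y) (fderiv ℝ φ y a) (fderiv ℝ φ y b) (fderiv ℝ φ y e)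
        + christoffelCLM h (φ y) (fderiv ℝ (fderiv ℝ φ) y a b) (fderiv ℝ φ y e)
        + christoffelCLM h (φ y) (fderiv ℝ φ y b) (fderiv ℝ (fderiv ℝ φ) y a e) := by
    have l := d1.clm_apply ((dg.clm_apply (c b)).clm_apply (c e))
    have r := ((d2.clm_apply (c b)).clm_apply (c e)).add
      ((dh.clm_apply (d1.clm_apply (c b))).clm_apply (d1.clm_apply (c e)))
    have heq : (fun z ↦ fderiv ℝ φ z (christoffelCLM g z b e)) =ᶠ[𝓝 y]
        fun z ↦ fderiv ℝ (fderiv ℝ φ) z b e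
          + christoffelCLM h (φ z) (fderiv ℝ φ z b) (fderiv ℝ φ z e) := by
      filter_upwards [hU] with z hz
      exact fderiv_christoffel hg hh hφ hφW hgh hz (hs z hz) b e
    have := congr($(l.unique (r.congr_of_eventuallyEq heq)) a)
    simp only [ContinuousLinearMap.comp_zero, zero_add, add_apply,
      ContinuousLinearMap.comp_apply, ContinuousLinearMap.flip_apply, Function.comp_apply] at this
    rw [add_comm, this]
    abel
  have hT (a b : E) : fderiv ℝ (fderiv ℝ φ) y a b = fderiv ℝ (fderiv ℝ φ) y b a :=
    ((hφ.contDiffAt hU).isSymmSndFDerivAt two_le_infty).eq a b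
  have hT3 : fderiv ℝ (fderiv ℝ (fderiv ℝ φ)) y u v = fderiv ℝ (fderiv ℝ (fderiv ℝ φ)) y v u :=
    ((hφ1.contDiffAt hU).isSymmSndFDerivAt two_le_infty).eq u v
  have tr (a b : E) : fderiv ℝ φ y (christoffelCLM g y a b) = fderiv ℝ (fderiv ℝ φ) y a b
      + christoffelCLM h (φ y) (fderiv ℝ φ y a) (fderiv ℝ φ y b) :=
    fderiv_christoffel hg hh hφ hφW hgh hy (hs y hy) a b
  rw [hg.coordCurvature_eq hy, hh.coordCurvature_eq (hφW hy), curvatureCLM_apply,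
    curvatureCLM_apply, map_sub, map_add, map_sub, tr u (christoffelCLM g y v w),
    tr v (christoffelCLM g y u w), tr u w, tr v w,
    eq_sub_of_add_eq' (key u v w), eq_sub_of_add_eq' (key v u w), hT3, hT v u]
  simp only [map_add]
  abel

end CoordinateMetric

/-! ### Linear differential equations and Jacobi fields in coordinates -/

section LinearODE

variable {F : Type*} [NormedAddCommGroup F] [NormedSpace ℝ F]

lemma norm_sub_zero_le_of_hasDerivWithinAt {f f' : ℝ → F} {C : ℝ}
    (hf : ∀ t ∈ Icc (0 : ℝ) 1, HasDerivWithinAt f (f' t) (Icc 0 1) t)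
    (hC : ∀ t ∈ Icc (0 : ℝ) 1, ‖f' t‖ ≤ C) {t : ℝ} (ht : t ∈ Icc (0 : ℝ) 1) :
    ‖f t - f 0‖ ≤ C := by
  have h0 : (0 : ℝ) ∈ Icc (0 : ℝ) 1 := by simp
  have := (convex_Icc (0 : ℝ) 1).norm_image_sub_le_of_norm_hasDerivWithin_le hf hC h0 ht
  refine this.trans ?_
  have hC0 : 0 ≤ C := (norm_nonneg _).trans (hC 0 h0)
  rw [sub_zero, Real.norm_of_nonneg ht.1]
  nlinarith [ht.2]

lemma eq_of_hasDerivWithinAt_zero {f : ℝ → F}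
    (hf : ∀ t ∈ Icc (0 : ℝ) 1, HasDerivWithinAt f 0 (Icc 0 1) t) {t : ℝ}
    (ht : t ∈ Icc (0 : ℝ) 1) : f t = f 0 := by
  have := norm_sub_zero_le_of_hasDerivWithinAt (C := 0) hf (by simp) ht
  rwa [norm_le_zero_iff, sub_eq_zero] at this

/-- A linear differential equation with small coefficients is solvable on all of `[0, 1]`, with
solutions close to their initial value. -/
lemma exists_linearODE_solution [CompleteSpace F] {L : ℝ → F →L[ℝ] F} {κ : ℝ} (hκ : κ ≤ 1 / 2)
    (hL : ContinuousOn L (Icc 0 1)) (hLκ : ∀ t ∈ Icc (0 : ℝ) 1, ‖L t‖ ≤ κ) {x₀ : F}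
    (hx₀ : ‖x₀‖ ≤ 1) :
    ∃ X : ℝ → F, X 0 = x₀ ∧
      (∀ t ∈ Icc (0 : ℝ) 1, HasDerivWithinAt X (L t (X t)) (Icc 0 1) t) ∧
      ∀ t ∈ Icc (0 : ℝ) 1, ‖X t - x₀‖ ≤ 2 * κ := by
  have h0 : (0 : ℝ) ∈ Icc (0 : ℝ) 1 := by simp
  have hκ0 : 0 ≤ κ := (norm_nonneg _).trans (hLκ 0 h0)
  lift κ to NNReal using hκ0
  -- on the ball of radius `1` around `x₀` the norms are at most `2`, so that the right-hand side is
  -- bounded by `2 * κ ≤ 1` and solutions stay in the ball up to time `1`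
  have hPL : IsPicardLindelof (fun t x ↦ L t x) (⟨0, h0⟩ : Icc (0 : ℝ) 1) x₀ 1 0 (2 * κ) κ :=
    { lipschitzOnWith := fun t ht ↦
        ((L t).lipschitz.weaken (NNReal.coe_le_coe.1 (hLκ t ht))).lipschitzOnWith
      continuousOn := fun x _ ↦ hL.clm_apply continuousOn_const
      norm_le := fun t ht x hx ↦ by
        have h1 : ‖x‖ ≤ 2 := by
          have := norm_le_norm_add_norm_sub' x x₀
          have h2 : ‖x - x₀‖ ≤ 1 := by simpa [dist_eq_norm] using hx
          linarith
        calc ‖L t x‖ ≤ ‖L t‖ * ‖x‖ := (L t).le_opNorm x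
          _ ≤ κ * 2 := by gcongr; exact hLκ t ht
          _ = _ := by push_cast; ring
      mul_max_le := by
        push_cast
        simp only [sub_zero, sub_self, zero_le_one, max_eq_left, mul_one]
        linarith }
  obtain ⟨X, hX0, hX⟩ := hPL.exists_eq_forall_mem_Icc_hasDerivWithinAt₀
  refine ⟨X, hX0, hX, ?_⟩
  have hcont : ContinuousOn X (Icc 0 1) := fun t ht ↦ (hX t ht).continuousWithinAt
  obtain ⟨m, hm, hmax⟩ := isCompact_Icc.exists_isMaxOn ⟨0, h0⟩ hcont.norm
  have hbound : ∀ t ∈ Icc (0 : ℝ) 1, ‖L t (X t)‖ ≤ κ * ‖X m‖ := fun t ht ↦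
    ((L t).le_opNorm _).trans (mul_le_mul (hLκ t ht) (hmax ht) (norm_nonneg _) κ.2)
  have hX0' : X 0 = x₀ := hX0
  have h1 (t : ℝ) (ht : t ∈ Icc (0 : ℝ) 1) : ‖X t - x₀‖ ≤ κ * ‖X m‖ := by
    rw [← hX0']
    exact norm_sub_zero_le_of_hasDerivWithinAt hX hbound ht
  have h2 : ‖X m‖ ≤ 2 := by
    have := norm_le_norm_add_norm_sub' (X m) x₀
    have := h1 m hm
    nlinarith [norm_nonneg (X m)]
  intro t ht
  have := h1 t ht
  have := κ.2
  nlinarith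

variable {E : Type*} [NormedAddCommGroup E] [NormedSpace ℝ E] [FiniteDimensional ℝ E]

/-- The propagator `P` of the linear equation `V' = -A V` on `[0, 1]`, for small `A`, together
with its inverse `Q`. -/
lemma exists_propagator {A : ℝ → E →L[ℝ] E} {κ : ℝ} (hκ : κ ≤ 1 / 2)
    (hA : ContinuousOn A (Icc 0 1)) (hAκ : ∀ t ∈ Icc (0 : ℝ) 1, ‖A t‖ ≤ κ) :
    ∃ P Q : ℝ → E →L[ℝ] E, P 0 = 1 ∧ Q 0 = 1 ∧
      (∀ t ∈ Icc (0 : ℝ) 1, HasDerivWithinAt P (-(A t ∘L P t)) (Icc 0 1) t) ∧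
      (∀ t ∈ Icc (0 : ℝ) 1, HasDerivWithinAt Q (Q t ∘L A t) (Icc 0 1) t) ∧
      (∀ t ∈ Icc (0 : ℝ) 1, ‖P t - 1‖ ≤ 2 * κ) ∧
      (∀ t ∈ Icc (0 : ℝ) 1, ‖Q t - 1‖ ≤ 2 * κ) ∧
      (∀ t ∈ Icc (0 : ℝ) 1, ∀ e, Q t (P t e) = e) ∧
      (∀ t ∈ Icc (0 : ℝ) 1, ∀ e, P t (Q t e) = e) := by
  have hone : ‖(1 : E →L[ℝ] E)‖ ≤ 1 := ContinuousLinearMap.norm_id_le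
  have hcomp : ‖ContinuousLinearMap.compL ℝ E E E‖ ≤ 1 :=
    ContinuousLinearMap.norm_compL_le ℝ E E E
  obtain ⟨P, hP0, hP, hP1⟩ := exists_linearODE_solution
    (L := fun t ↦ -(ContinuousLinearMap.compL ℝ E E E (A t))) hκ
    (((ContinuousLinearMap.compL ℝ E E E).continuous.comp_continuousOn hA).neg)
    (fun t ht ↦ by
      rw [norm_neg]
      refine ((ContinuousLinearMap.compL ℝ E E E).le_opNorm _).trans ?_
      nlinarith [hAκ t ht, norm_nonneg (A t)]) hone
  obtain ⟨Q, hQ0, hQ, hQ1⟩ := exists_linearODE_solution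
    (L := fun t ↦ (ContinuousLinearMap.compL ℝ E E E).flip (A t)) hκ
    (((ContinuousLinearMap.compL ℝ E E E).flip.continuous.comp_continuousOn hA))
    (fun t ht ↦ by
      refine ((ContinuousLinearMap.compL ℝ E E E).flip.le_opNorm _).trans ?_
      rw [ContinuousLinearMap.opNorm_flip]
      nlinarith [hAκ t ht, norm_nonneg (A t)]) hone
  have hP' : ∀ t ∈ Icc (0 : ℝ) 1, HasDerivWithinAt P (-(A t ∘L P t)) (Icc 0 1) t := hP
  have hQ' : ∀ t ∈ Icc (0 : ℝ) 1, HasDerivWithinAt Q (Q t ∘L A t) (Icc 0 1) t := hQ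
  have hQP : ∀ t ∈ Icc (0 : ℝ) 1, Q t ∘L P t = 1 := by
    intro t ht
    have : ∀ t ∈ Icc (0 : ℝ) 1, HasDerivWithinAt (fun t ↦ Q t ∘L P t) 0 (Icc 0 1) t := by
      intro t ht
      refine ((hQ' t ht).clm_comp (hP' t ht)).congr_deriv ?_
      ext e
      simp
    rw [eq_of_hasDerivWithinAt_zero this ht, hP0, hQ0]
    rfl
  have hQP' : ∀ t ∈ Icc (0 : ℝ) 1, ∀ e, Q t (P t e) = e := fun t ht e ↦
    congr($(hQP t ht) e)
  refine ⟨P, Q, hP0, hQ0, hP', hQ', hP1, hQ1, hQP', ?_⟩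
  intro t ht e
  have hinj : Function.Injective (P t : E →ₗ[ℝ] E) :=
    Function.LeftInverse.injective (g := Q t) (hQP' t ht)
  obtain ⟨e', rfl⟩ := LinearMap.injective_iff_surjective.1 hinj e
  exact congr(P t $(hQP' t ht e'))

end LinearODE

section BoundaryValue

variable {F : Type*} [NormedAddCommGroup F] [NormedSpace ℝ F]

/-- The solution of `z'' = f` vanishing at both endpoints of `[0, 1]` is controlled by `f`. -/
lemma norm_le_of_second_deriv {z z' z'' : ℝ → F} {m : ℝ}
    (h1 : ∀ t ∈ Icc (0 : ℝ) 1, HasDerivWithinAt z (z' t) (Icc 0 1) t)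
    (h2 : ∀ t ∈ Icc (0 : ℝ) 1, HasDerivWithinAt z' (z'' t) (Icc 0 1) t)
    (h0 : z 0 = 0) (h01 : z 1 = 0) (hm : ∀ t ∈ Icc (0 : ℝ) 1, ‖z'' t‖ ≤ m)
    {t : ℝ} (ht : t ∈ Icc (0 : ℝ) 1) : ‖z t‖ ≤ 2 * m := by
  have ha (t : ℝ) (ht : t ∈ Icc (0 : ℝ) 1) : ‖z' t - z' 0‖ ≤ m :=
    norm_sub_zero_le_of_hasDerivWithinAt h2 hm ht
  have hd (t : ℝ) (ht : t ∈ Icc (0 : ℝ) 1) :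
      HasDerivWithinAt (fun t ↦ z t - t • z' 0) (z' t - z' 0) (Icc 0 1) t := by
    refine ((h1 t ht).sub ((hasDerivWithinAt_id t _).smul_const (z' 0))).congr_deriv ?_
    simp
  have hb (t : ℝ) (ht : t ∈ Icc (0 : ℝ) 1) : ‖z t - t • z' 0‖ ≤ m := by
    simpa [h0] using norm_sub_zero_le_of_hasDerivWithinAt hd ha ht
  have hc : ‖z' 0‖ ≤ m := by simpa [h01] using hb 1 (by simp)
  calc ‖z t‖ = ‖(z t - t • z' 0) + t • z' 0‖ := by simp
    _ ≤ ‖z t - t • z' 0‖ + ‖t • z' 0‖ := norm_add_le _ _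
    _ ≤ m + 1 * m := by
      rw [norm_smul, Real.norm_of_nonneg ht.1]
      exact add_le_add (hb t ht) (mul_le_mul ht.2 hc (norm_nonneg _) zero_le_one)
    _ = 2 * m := by ring

/-- The boundary value problem `u'' = B u + error` on `[0, 1]` for a small operator `B`: to first
order in `B`, the solution is the linear interpolation of the boundary values corrected by the
cubic polynomial whose second derivative is `B` applied to that interpolation. -/
lemma norm_sub_cubic_le {u u' u'' : ℝ → F} {B : F →L[ℝ] F} {b e : ℝ}
    (h1 : ∀ t ∈ Icc (0 : ℝ) 1, HasDerivWithinAt u (u' t) (Icc 0 1) t)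
    (h2 : ∀ t ∈ Icc (0 : ℝ) 1, HasDerivWithinAt u' (u'' t) (Icc 0 1) t)
    (hB : ‖B‖ ≤ b) (hb : b ≤ 1 / 8) (he : e ≤ 1 / 8)
    (hu : ∀ t ∈ Icc (0 : ℝ) 1, ‖u'' t - B (u t)‖ ≤ e * ‖u t‖)
    (he0 : 0 ≤ e) {t : ℝ} (ht : t ∈ Icc (0 : ℝ) 1) :
    ‖u t - (t • u 1 + (1 - t) • u 0 + ((t ^ 3 - t) / 6) • B (u 1)
      - ((t ^ 3 - 3 * t ^ 2 + 2 * t) / 6) • B (u 0))‖ ≤ 8 * (e + b ^ 2) * max ‖u 0‖ ‖u 1‖ := by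
  have h0 : (0 : ℝ) ∈ Icc (0 : ℝ) 1 := by simp
  have hb0 : 0 ≤ b := (norm_nonneg _).trans hB
  set X := max ‖u 0‖ ‖u 1‖ with hX
  have hcont : ContinuousOn u (Icc 0 1) := fun t ht ↦ (h1 t ht).continuousWithinAt
  obtain ⟨m, hm, hmax⟩ := isCompact_Icc.exists_isMaxOn ⟨0, h0⟩ hcont.norm
  set M := ‖u m‖ with hM
  have hM0 : 0 ≤ M := norm_nonneg _
  have hmax' : ∀ t ∈ Icc (0 : ℝ) 1, ‖u t‖ ≤ M := fun t ht ↦ hmax ht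
  have hBle (x : F) : ‖B x‖ ≤ b * ‖x‖ := (B.le_opNorm x).trans (by gcongr)
  have hu2 : ∀ t ∈ Icc (0 : ℝ) 1, ‖u'' t‖ ≤ (b + e) * M := by
    intro t ht
    have e1 : u'' t = (u'' t - B (u t)) + B (u t) := by simp
    rw [e1]
    refine (norm_add_le _ _).trans ?_
    have e2 := hu t ht
    have e3 := hBle (u t)
    have e4 := hmax' t ht
    have e5 : (b + e) * ‖u t‖ ≤ (b + e) * M := by gcongr
    linarith
  -- the linear interpolation
  have hl (t : ℝ) : HasDerivWithinAt (fun t : ℝ ↦ t • u 1 + (1 - t) • u 0) (u 1 - u 0)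
      (Icc 0 1) t := by
    have := ((hasDerivWithinAt_id t (Icc (0 : ℝ) 1)).smul_const (u 1)).add
      (((hasDerivWithinAt_id t (Icc (0 : ℝ) 1)).const_sub 1).smul_const (u 0))
    refine this.congr_deriv ?_
    module
  have hlin : ∀ t ∈ Icc (0 : ℝ) 1, ‖u t - (t • u 1 + (1 - t) • u 0)‖ ≤ 2 * ((b + e) * M) := by
    intro t ht
    exact norm_le_of_second_deriv (z := fun t ↦ u t - (t • u 1 + (1 - t) • u 0))
      (z' := fun t ↦ u' t - (u 1 - u 0)) (z'' := u'')
      (fun t ht ↦ (h1 t ht).sub (hl t)) (fun t ht ↦ (h2 t ht).sub_const _)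
      (by simp) (by simp) hu2 ht
  have hMX : M ≤ 2 * X := by
    have e1 := hlin m hm
    have e2 : ‖m • u 1 + (1 - m) • u 0‖ ≤ X := by
      refine (norm_add_le _ _).trans ?_
      rw [norm_smul, norm_smul, Real.norm_of_nonneg hm.1,
        Real.norm_of_nonneg (sub_nonneg.2 hm.2)]
      have e3 : m * ‖u 1‖ ≤ m * X := mul_le_mul_of_nonneg_left (le_max_right _ _) hm.1
      have e4 : (1 - m) * ‖u 0‖ ≤ (1 - m) * X :=
        mul_le_mul_of_nonneg_left (le_max_left _ _) (sub_nonneg.2 hm.2)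
      linarith
    have e5 := norm_le_norm_add_norm_sub' (u m) (m • u 1 + (1 - m) • u 0)
    nlinarith
  -- the difference with the cubic interpolation
  have hq (t : ℝ) : HasDerivWithinAt (fun t : ℝ ↦ ((t ^ 3 - t) / 6) • B (u 1)
      - ((t ^ 3 - 3 * t ^ 2 + 2 * t) / 6) • B (u 0))
      (((3 * t ^ 2 - 1) / 6) • B (u 1) - ((3 * t ^ 2 - 6 * t + 2) / 6) • B (u 0))
      (Icc 0 1) t := by
    have i := hasDerivWithinAt_id t (Icc (0 : ℝ) 1)
    have := ((((i.pow 3).sub i).div_const 6).smul_const (B (u 1))).sub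
      (((((i.pow 3).sub ((i.pow 2).const_mul 3)).add (i.const_mul 2)).div_const 6).smul_const
        (B (u 0)))
    refine this.congr_deriv ?_
    simp only [id]
    module
  have hq' (t : ℝ) : HasDerivWithinAt (fun t : ℝ ↦
      ((3 * t ^ 2 - 1) / 6) • B (u 1) - ((3 * t ^ 2 - 6 * t + 2) / 6) • B (u 0))
      (B (t • u 1 + (1 - t) • u 0)) (Icc 0 1) t := by
    have i := hasDerivWithinAt_id t (Icc (0 : ℝ) 1)
    have := (((((i.pow 2).const_mul 3).sub_const 1).div_const 6).smul_const (B (u 1))).sub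
      ((((((i.pow 2).const_mul 3).sub (i.const_mul 6)).add_const 2).div_const 6).smul_const
        (B (u 0)))
    refine this.congr_deriv ?_
    simp only [id, map_add, map_smul]
    module
  have hfinal := norm_le_of_second_deriv
    (z := fun t ↦ u t - (t • u 1 + (1 - t) • u 0) - (((t ^ 3 - t) / 6) • B (u 1)
      - ((t ^ 3 - 3 * t ^ 2 + 2 * t) / 6) • B (u 0)))
    (m := (2 * e + 2 * b ^ 2) * M)
    (fun t ht ↦ ((h1 t ht).sub (hl t)).sub (hq t))
    (fun t ht ↦ ((h2 t ht).sub_const (u 1 - u 0)).sub (hq' t))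
    (by simp) (by norm_num) (fun t ht ↦ by
      have e1 : u'' t - B (t • u 1 + (1 - t) • u 0)
          = (u'' t - B (u t)) + B (u t - (t • u 1 + (1 - t) • u 0)) := by
        rw [map_sub]; abel
      rw [e1]
      refine (norm_add_le _ _).trans ?_
      have e2 := hu t ht
      have e3 := (hBle (u t - (t • u 1 + (1 - t) • u 0))).trans
        (mul_le_mul_of_nonneg_left (hlin t ht) hb0)
      have e4 : e * ‖u t‖ ≤ e * M := mul_le_mul_of_nonneg_left (hmax' t ht) he0
      have e5 : b * e * M ≤ 1 / 8 * e * M := by gcongr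
      nlinarith [mul_nonneg he0 hM0]) ht
  have e6 : u t - (t • u 1 + (1 - t) • u 0 + ((t ^ 3 - t) / 6) • B (u 1)
      - ((t ^ 3 - 3 * t ^ 2 + 2 * t) / 6) • B (u 0)) =
      u t - (t • u 1 + (1 - t) • u 0) - (((t ^ 3 - t) / 6) • B (u 1)
      - ((t ^ 3 - 3 * t ^ 2 + 2 * t) / 6) • B (u 0)) := by abel
  rw [e6]
  refine hfinal.trans ?_
  have : 0 ≤ e + b ^ 2 := by positivity
  nlinarith

end BoundaryValue

section Jacobi

variable {E : Type*} [NormedAddCommGroup E] [NormedSpace ℝ E]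

lemma norm_trilinear_le (S : E →L[ℝ] E →L[ℝ] E →L[ℝ] E) {a b c : E} {s α β γ : ℝ}
    (hS : ‖S‖ ≤ s) (ha : ‖a‖ ≤ α) (hb : ‖b‖ ≤ β) (hc : ‖c‖ ≤ γ) :
    ‖S a b c‖ ≤ s * α * β * γ := by
  have hs0 := (norm_nonneg _).trans hS
  have ha0 := (norm_nonneg _).trans ha
  have hb0 := (norm_nonneg _).trans hb
  have h1 : ‖S a b‖ ≤ s * α * β := (S.le_opNorm₂ a b).trans (by gcongr)
  exact ((S a b).le_opNorm c).trans (by gcongr)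

/-- The covariant derivative of a field `J` along a curve, transported to the initial point. -/
lemma hasDerivWithinAt_transport {Γ : E → E →L[ℝ] E →L[ℝ] E} {x v J J' : ℝ → E}
    {Q : ℝ → E →L[ℝ] E} {s : Set ℝ} {t : ℝ}
    (hJ : HasDerivWithinAt J (J' t) s t)
    (hQ : HasDerivWithinAt Q (Q t ∘L Γ (x t) (v t)) s t) :
    HasDerivWithinAt (fun τ ↦ Q τ (J τ)) (Q t (J' t + Γ (x t) (v t) (J t))) s t := by
  refine (hQ.clm_apply hJ).congr_deriv ?_
  simp [add_comm]

/-- The Jacobi equation `D²J = R(v, J) v`, for a variation field `J` of geodesics, that is, a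
solution of the linearized geodesic equation. -/
lemma hasDerivWithinAt_covDeriv {Γ : E → E →L[ℝ] E →L[ℝ] E} {x v J J' : ℝ → E}
    {s : Set ℝ} {t : ℝ} (hΓ : DifferentiableAt ℝ Γ (x t))
    (hsymm : ∀ᶠ y in 𝓝 (x t), ∀ a b, Γ y a b = Γ y b a)
    (hx : HasDerivWithinAt x (v t) s t)
    (hv : HasDerivWithinAt v (-Γ (x t) (v t) (v t)) s t)
    (hJ : HasDerivWithinAt J (J' t) s t)
    (hJ' : HasDerivWithinAt J'
      (-fderiv ℝ Γ (x t) (J t) (v t) (v t) - (2 : ℝ) • Γ (x t) (v t) (J' t)) s t) :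
    HasDerivWithinAt (fun τ ↦ J' τ + Γ (x τ) (v τ) (J τ))
      (curvatureCLM Γ (x t) (v t) (J t) (v t)
        - Γ (x t) (v t) (J' t + Γ (x t) (v t) (J t))) s t := by
  have h1 : HasDerivWithinAt (fun τ ↦ Γ (x τ)) (fderiv ℝ Γ (x t) (v t)) s t :=
    hΓ.hasFDerivAt.comp_hasDerivWithinAt t hx
  have hD : fderiv ℝ Γ (x t) (v t) (v t) (J t) = fderiv ℝ Γ (x t) (v t) (J t) (v t) := by
    have h2 (a b : E) := (hΓ.hasFDerivAt.clm_apply (hasFDerivAt_const a (x t))).clm_apply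
      (hasFDerivAt_const b (x t))
    have h3 : (fun y ↦ Γ y (v t) (J t)) =ᶠ[𝓝 (x t)] fun y ↦ Γ y (J t) (v t) := by
      filter_upwards [hsymm] with y hy using hy _ _
    simpa using congr($((h2 (v t) (J t)).unique ((h2 (J t) (v t)).congr_of_eventuallyEq h3)) (v t))
  refine (hJ'.add ((h1.clm_apply hv).clm_apply hJ)).congr_deriv ?_
  have hs := hsymm.self_of_nhds
  rw [curvatureCLM_apply, ← hD, hs (J t) (Γ (x t) (v t) (v t)), hs (J t) (v t)]
  simp only [add_apply, map_neg, neg_apply, map_add]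
  module

/-- The expansion of a Jacobi field along a geodesic of small speed, in coordinates. The constant
`A` bounds the Christoffel symbols, the curvature and its derivative along the geodesic, and `η`
bounds the speed; the Jacobi field is transported to the initial point by `Q`. -/
lemma norm_jacobi_sub_cubic_le {Γ : E → E →L[ℝ] E →L[ℝ] E} {x v J J' : ℝ → E}
    {P Q : ℝ → E →L[ℝ] E} {A η : ℝ} (hA : 1 ≤ A) (hη : A * η ≤ 1 / 32)
    (hΓ : ∀ t ∈ Icc (0 : ℝ) 1, DifferentiableAt ℝ Γ (x t))
    (hR : ∀ t ∈ Icc (0 : ℝ) 1, DifferentiableAt ℝ (curvatureCLM Γ) (x t))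
    (hsymm : ∀ t ∈ Icc (0 : ℝ) 1, ∀ᶠ y in 𝓝 (x t), ∀ a b, Γ y a b = Γ y b a)
    (hΓA : ∀ t ∈ Icc (0 : ℝ) 1, ‖Γ (x t)‖ ≤ A)
    (hRA : ∀ t ∈ Icc (0 : ℝ) 1, ‖curvatureCLM Γ (x t)‖ ≤ A)
    (hRA' : ∀ t ∈ Icc (0 : ℝ) 1, ‖fderiv ℝ (curvatureCLM Γ) (x t)‖ ≤ A)
    (hvη : ∀ t ∈ Icc (0 : ℝ) 1, ‖v t‖ ≤ η)
    (hx : ∀ t ∈ Icc (0 : ℝ) 1, HasDerivWithinAt x (v t) (Icc 0 1) t)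
    (hv : ∀ t ∈ Icc (0 : ℝ) 1, HasDerivWithinAt v (-Γ (x t) (v t) (v t)) (Icc 0 1) t)
    (hJ : ∀ t ∈ Icc (0 : ℝ) 1, HasDerivWithinAt J (J' t) (Icc 0 1) t)
    (hJ' : ∀ t ∈ Icc (0 : ℝ) 1, HasDerivWithinAt J'
      (-fderiv ℝ Γ (x t) (J t) (v t) (v t) - (2 : ℝ) • Γ (x t) (v t) (J' t)) (Icc 0 1) t)
    (hQ : ∀ t ∈ Icc (0 : ℝ) 1, HasDerivWithinAt Q (Q t ∘L Γ (x t) (v t)) (Icc 0 1) t)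
    (hP1 : ∀ t ∈ Icc (0 : ℝ) 1, ‖P t - 1‖ ≤ 2 * (A * η))
    (hQ1 : ∀ t ∈ Icc (0 : ℝ) 1, ‖Q t - 1‖ ≤ 2 * (A * η))
    (hPQ : ∀ t ∈ Icc (0 : ℝ) 1, ∀ e, P t (Q t e) = e)
    {t : ℝ} (ht : t ∈ Icc (0 : ℝ) 1) :
    ‖Q t (J t) - (t • Q 1 (J 1) + (1 - t) • Q 0 (J 0)
      + ((t ^ 3 - t) / 6) • curvatureCLM Γ (x 0) (v 0) (Q 1 (J 1)) (v 0)
      - ((t ^ 3 - 3 * t ^ 2 + 2 * t) / 6) • curvatureCLM Γ (x 0) (v 0) (Q 0 (J 0)) (v 0))‖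
      ≤ 112 * A ^ 2 * η ^ 3 * max ‖Q 0 (J 0)‖ ‖Q 1 (J 1)‖ := by
  have h0 : (0 : ℝ) ∈ Icc (0 : ℝ) 1 := by simp
  have hη0 : 0 ≤ η := (norm_nonneg _).trans (hvη 0 h0)
  have hη1 : η ≤ 1 / 32 := by nlinarith
  have hA0 : 0 ≤ A := by linarith
  set κ := A * η with hκ
  have hκ0 : 0 ≤ κ := by positivity
  have hu1 : ∀ t ∈ Icc (0 : ℝ) 1, HasDerivWithinAt (fun τ ↦ Q τ (J τ))
      (Q t (J' t + Γ (x t) (v t) (J t))) (Icc 0 1) t :=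
    fun t ht ↦ hasDerivWithinAt_transport (hJ t ht) (hQ t ht)
  have hu2 : ∀ t ∈ Icc (0 : ℝ) 1, HasDerivWithinAt
      (fun τ ↦ Q τ (J' τ + Γ (x τ) (v τ) (J τ)))
      (Q t (curvatureCLM Γ (x t) (v t) (J t) (v t))) (Icc 0 1) t := by
    intro t ht
    have := (hQ t ht).clm_apply (hasDerivWithinAt_covDeriv (hΓ t ht) (hsymm t ht) (hx t ht)
      (hv t ht) (hJ t ht) (hJ' t ht))
    refine this.congr_deriv ?_
    rw [map_sub]
    simp
  have hvv : ∀ t ∈ Icc (0 : ℝ) 1, ‖v t - v 0‖ ≤ κ * η := by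
    intro t ht
    refine norm_sub_zero_le_of_hasDerivWithinAt hv (fun t ht ↦ ?_) ht
    rw [norm_neg]
    refine ((Γ (x t)).le_opNorm₂ _ _).trans ?_
    have := hΓA t ht
    have := hvη t ht
    rw [hκ]
    gcongr
  have hRR : ∀ t ∈ Icc (0 : ℝ) 1,
      ‖curvatureCLM Γ (x t) - curvatureCLM Γ (x 0)‖ ≤ κ := by
    intro t ht
    refine norm_sub_zero_le_of_hasDerivWithinAt (f := fun t ↦ curvatureCLM Γ (x t))
      (fun t ht ↦ (hR t ht).hasFDerivAt.comp_hasDerivWithinAt t (hx t ht)) (fun t ht ↦ ?_) ht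
    refine ((fderiv ℝ (curvatureCLM Γ) (x t)).le_opNorm _).trans ?_
    have := hRA' t ht
    have := hvη t ht
    rw [hκ]
    gcongr
  -- the operator `w ↦ R(v, w) v` at the initial point
  set B : E →L[ℝ] E := (curvatureCLM Γ (x 0) (v 0)).flip (v 0) with hB
  have hBn : ‖B‖ ≤ A * η ^ 2 := by
    refine B.opNorm_le_bound (by positivity) fun w ↦ ?_
    have := norm_trilinear_le _ (hRA 0 h0) (hvη 0 h0) le_rfl (hvη 0 h0) (b := w)
    rw [hB, ContinuousLinearMap.flip_apply]
    linarith
  have herr : ∀ t ∈ Icc (0 : ℝ) 1, ‖Q t (curvatureCLM Γ (x t) (v t) (J t) (v t)) - B (Q t (J t))‖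
      ≤ 13 * A ^ 2 * η ^ 3 * ‖Q t (J t)‖ := by
    intro t ht
    set S := curvatureCLM Γ (x t)
    set w := Q t (J t) with hw
    have hJw : J t = P t w := (hPQ t ht _).symm
    have hJ2 : ‖J t - w‖ ≤ 2 * κ * ‖w‖ := by
      have : J t - w = (P t - 1) w := by rw [hJw]; simp
      rw [this]
      exact ((P t - 1).le_opNorm w).trans (by gcongr; exact hP1 t ht)
    have hJ1 : ‖J t‖ ≤ 2 * ‖w‖ := by
      have := norm_le_norm_add_norm_sub' (J t) w
      nlinarith [norm_nonneg w]
    -- `v`, `J` and `R` are replaced by their values after transport to the initial point, one at a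
    -- time; each replacement costs a factor `O(η)`
    have split : Q t (S (v t) (J t) (v t)) - B w =
        (Q t - 1) (S (v t) (J t) (v t)) + S (v t - v 0) (J t) (v t) + S (v 0) (J t - w) (v t)
          + S (v 0) w (v t - v 0) + (S - curvatureCLM Γ (x 0)) (v 0) w (v 0) := by
      simp only [hB, sub_apply, map_sub, ContinuousLinearMap.flip_apply,
        one_apply_eq_self]
      abel
    have n1 : ‖(Q t - 1) (S (v t) (J t) (v t))‖ ≤ 2 * κ * (A * η * (2 * ‖w‖) * η) := by
      refine ((Q t - 1).le_opNorm _).trans ?_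
      have := norm_trilinear_le S (hRA t ht) (hvη t ht) hJ1 (hvη t ht)
      have := hQ1 t ht
      gcongr
    have n2 := norm_trilinear_le S (hRA t ht) (hvv t ht) hJ1 (hvη t ht)
    have n3 := norm_trilinear_le S (hRA t ht) (hvη 0 h0) hJ2 (hvη t ht)
    have n4 := norm_trilinear_le S (hRA t ht) (hvη 0 h0) (le_refl ‖w‖) (hvv t ht)
    have n5 := norm_trilinear_le _ (hRR t ht) (hvη 0 h0) (le_refl ‖w‖) (hvη 0 h0)
    rw [split]
    refine (norm_add_le _ _).trans ?_
    refine (add_le_add_left (norm_add_le _ _) _).trans ?_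
    refine (add_le_add_left (add_le_add_left (norm_add_le _ _) _) _).trans ?_
    refine (add_le_add_left (add_le_add_left (add_le_add_left (norm_add_le _ _) _) _) _).trans ?_
    have n6 : A * η ^ 3 * ‖w‖ ≤ A ^ 2 * η ^ 3 * ‖w‖ := by
      gcongr
      nlinarith
    rw [hκ] at n1 n2 n3 n4 n5
    have n0 : 0 ≤ A ^ 2 * η ^ 3 * ‖w‖ := by positivity
    linarith
  have hsmall : A * η ^ 2 ≤ 1 / 8 := by
    have : A * η ^ 2 = κ * η := by rw [hκ]; ring
    rw [this]
    nlinarith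
  have hsmall' : 13 * A ^ 2 * η ^ 3 ≤ 1 / 8 := by
    have : 13 * A ^ 2 * η ^ 3 = 13 * (κ * κ) * η := by rw [hκ]; ring
    rw [this]
    have : κ * κ ≤ 1 / 32 * (1 / 32) := by gcongr
    nlinarith
  refine (norm_sub_cubic_le hu1 hu2 hBn hsmall hsmall' herr (by positivity) ht).trans ?_
  refine mul_le_mul_of_nonneg_right ?_ (le_max_of_le_left (norm_nonneg _))
  have : (A * η ^ 2) ^ 2 = A ^ 2 * η ^ 3 * η := by ring
  rw [this]
  have n0 : 0 ≤ A ^ 2 * η ^ 3 := by positivity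
  nlinarith

end Jacobi

/-! ### Changes of charts -/

section Charts

variable {E : Type*} [NormedAddCommGroup E] [NormedSpace ℝ E]
  {M : Type*} [TopologicalSpace M] [ChartedSpace E M] [IsManifold 𝓘(ℝ, E) ∞ M]

lemma ofChart_toChart {p x : M} (hx : x ∈ (chartAt E p).source) (v : TangentSpace 𝓘(ℝ, E) x) :
    ofChart p x (toChart p x v) = v :=
  (trivializationAt E (TangentSpace 𝓘(ℝ, E)) p).symmL_continuousLinearMapAt (R := ℝ)
    (by simpa using hx) v

/-- The change of coordinates from the chart centred at `p` to the chart centred at `q`. -/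
def transition (E : Type*) [NormedAddCommGroup E] [NormedSpace ℝ E]
    {M : Type*} [TopologicalSpace M] [ChartedSpace E M] (p q : M) : E → E :=
  extChartAt 𝓘(ℝ, E) q ∘ (extChartAt 𝓘(ℝ, E) p).symm

/-- The domain of the change of coordinates `transition E p q`. -/
def transitionSource (E : Type*) [NormedAddCommGroup E] [NormedSpace ℝ E]
    {M : Type*} [TopologicalSpace M] [ChartedSpace E M] (p q : M) : Set E :=
  (extChartAt 𝓘(ℝ, E) p).target ∩ (extChartAt 𝓘(ℝ, E) p).symm ⁻¹' (chartAt E q).source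

omit [IsManifold 𝓘(ℝ, E) ∞ M] in
lemma mem_transitionSource {p q : M} {y : E} : y ∈ transitionSource E p q ↔
    y ∈ (extChartAt 𝓘(ℝ, E) p).target ∧
      (extChartAt 𝓘(ℝ, E) p).symm y ∈ (chartAt E q).source := Iff.rfl

omit [IsManifold 𝓘(ℝ, E) ∞ M] in
lemma extChartAt_mem_transitionSource {p q x : M} (hp : x ∈ (chartAt E p).source)
    (hq : x ∈ (chartAt E q).source) : extChartAt 𝓘(ℝ, E) p x ∈ transitionSource E p q := by
  have hp' : x ∈ (extChartAt 𝓘(ℝ, E) p).source := by rwa [extChartAt_source]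
  rw [mem_transitionSource, PartialEquiv.left_inv _ hp']
  exact ⟨(extChartAt 𝓘(ℝ, E) p).map_source hp', hq⟩

omit [IsManifold 𝓘(ℝ, E) ∞ M] in
lemma symm_mem_source {p : M} {y : E} (hy : y ∈ (extChartAt 𝓘(ℝ, E) p).target) :
    (extChartAt 𝓘(ℝ, E) p).symm y ∈ (chartAt E p).source := by
  rw [← extChartAt_source 𝓘(ℝ, E)]
  exact (extChartAt 𝓘(ℝ, E) p).map_target hy

omit [IsManifold 𝓘(ℝ, E) ∞ M] in
lemma isOpen_transitionSource (p q : M) : IsOpen (transitionSource E p q) :=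
  (continuousOn_extChartAt_symm p).isOpen_inter_preimage (isOpen_extChartAt_target p)
    (chartAt E q).open_source

lemma contDiffOn_transition (p q : M) :
    ContDiffOn ℝ ∞ (transition E p q) (transitionSource E p q) := by
  have := contDiffOn_ext_coord_change (I := 𝓘(ℝ, E)) (n := ∞) q p
  rwa [PartialEquiv.trans_source, PartialEquiv.symm_source, extChartAt_source 𝓘(ℝ, E) q] at this

omit [IsManifold 𝓘(ℝ, E) ∞ M] in
lemma mapsTo_transition (p q : M) :
    MapsTo (transition E p q) (transitionSource E p q) (extChartAt 𝓘(ℝ, E) q).target := by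
  intro y hy
  rw [mem_transitionSource] at hy
  exact (extChartAt 𝓘(ℝ, E) q).map_source (by rw [extChartAt_source]; exact hy.2)

omit [IsManifold 𝓘(ℝ, E) ∞ M] in
lemma transition_extChartAt {p q x : M} (hp : x ∈ (chartAt E p).source) :
    transition E p q (extChartAt 𝓘(ℝ, E) p x) = extChartAt 𝓘(ℝ, E) q x := by
  rw [transition, Function.comp_apply, PartialEquiv.left_inv _ (by rwa [extChartAt_source])]

lemma mdifferentiableAt_extChartAt' {p x : M} (hp : x ∈ (chartAt E p).source) :
    MDifferentiableAt 𝓘(ℝ, E) 𝓘(ℝ, E) (extChartAt 𝓘(ℝ, E) p) x :=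
  (contMDiffAt_extChartAt' (n := ∞) hp).mdifferentiableAt (by simp)

lemma differentiableAt_transition {p q : M} {y : E} (hy : y ∈ transitionSource E p q) :
    DifferentiableAt ℝ (transition E p q) y :=
  ((contDiffOn_transition p q).contDiffAt
    ((isOpen_transitionSource p q).mem_nhds hy)).differentiableAt (by simp)

/-- The coordinates of a tangent vector in two charts are related by the differential of the change
of coordinates. -/
lemma fderiv_transition_toChart {p q x : M} (hp : x ∈ (chartAt E p).source)
    (hq : x ∈ (chartAt E q).source) (v : TangentSpace 𝓘(ℝ, E) x) :
    fderiv ℝ (transition E p q) (extChartAt 𝓘(ℝ, E) p x) (toChart p x v) = toChart q x v := by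
  have hd := differentiableAt_transition (extChartAt_mem_transitionSource hp hq)
  have heq : extChartAt 𝓘(ℝ, E) q =ᶠ[𝓝 x] transition E p q ∘ extChartAt 𝓘(ℝ, E) p := by
    filter_upwards [(chartAt E p).open_source.mem_nhds hp] with z hz
    exact (transition_extChartAt hz).symm
  rw [toChart_eq_mfderiv hp, toChart_eq_mfderiv hq, heq.mfderiv_eq,
    mfderiv_comp x hd.mdifferentiableAt (mdifferentiableAt_extChartAt' hp), mfderiv_eq_fderiv]
  rfl

lemma fderiv_transition_eq {p q : M} {y : E} (hy : y ∈ transitionSource E p q) (u : E) :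
    fderiv ℝ (transition E p q) y u = toChart q ((extChartAt 𝓘(ℝ, E) p).symm y)
      (ofChart p ((extChartAt 𝓘(ℝ, E) p).symm y) u) := by
  obtain ⟨hy1, hy2⟩ := mem_transitionSource.1 hy
  rw [← fderiv_transition_toChart (symm_mem_source hy1) hy2,
    toChart_ofChart (symm_mem_source hy1), PartialEquiv.right_inv _ hy1]

lemma surjective_fderiv_transition {p q : M} {y : E} (hy : y ∈ transitionSource E p q) :
    Function.Surjective (fderiv ℝ (transition E p q) y) := by
  obtain ⟨hy1, hy2⟩ := mem_transitionSource.1 hy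
  intro w
  refine ⟨toChart p ((extChartAt 𝓘(ℝ, E) p).symm y)
    (ofChart q ((extChartAt 𝓘(ℝ, E) p).symm y) w), ?_⟩
  rw [fderiv_transition_eq hy, ofChart_toChart (symm_mem_source hy1), toChart_ofChart hy2]

/-- The differential of a curve, in a chart. -/
lemma hasDerivWithinAt_extChartAt {c : ℝ → M} {s : Set ℝ} {t : ℝ} {p : M}
    (hc : MDifferentiableWithinAt 𝓘(ℝ, ℝ) 𝓘(ℝ, E) c s t) (hp : c t ∈ (chartAt E p).source) :
    HasDerivWithinAt (fun τ ↦ extChartAt 𝓘(ℝ, E) p (c τ))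
      (toChart p (c t) (mfderivWithin 𝓘(ℝ, ℝ) 𝓘(ℝ, E) c s t (1 : ℝ))) s t := by
  have h1 := (mdifferentiableAt_extChartAt' hp).hasMFDerivAt.comp_hasMFDerivWithinAt t
    hc.hasMFDerivWithinAt
  have h2 : HasFDerivWithinAt (extChartAt 𝓘(ℝ, E) p ∘ c)
      ((toChart p (c t)).comp (mfderivWithin 𝓘(ℝ, ℝ) 𝓘(ℝ, E) c s t) : ℝ →L[ℝ] E) s t := by
    rw [toChart_eq_mfderiv hp]
    exact h1.hasFDerivWithinAt
  exact h2.hasDerivWithinAt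

lemma contMDiffOn_ofChart (p : M) (u : E) :
    ContMDiffOn 𝓘(ℝ, E) (𝓘(ℝ, E).prod 𝓘(ℝ, E)) ∞
      (fun y ↦ (⟨(extChartAt 𝓘(ℝ, E) p).symm y,
        ofChart p ((extChartAt 𝓘(ℝ, E) p).symm y) u⟩ : TangentBundle 𝓘(ℝ, E) M))
      (extChartAt 𝓘(ℝ, E) p).target := by
  have : IsManifold 𝓘(ℝ, E) ((∞ : WithTop ℕ∞) + 1) M := by simpa
  have h1 := (trivializationAt E (TangentSpace 𝓘(ℝ, E) (M := M)) p).contMDiffOn_symm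
    (IB := 𝓘(ℝ, E)) (n := ∞)
  have h2 : ContMDiffOn 𝓘(ℝ, E) (𝓘(ℝ, E).prod 𝓘(ℝ, E)) ∞
      (fun y ↦ ((extChartAt 𝓘(ℝ, E) p).symm y, u)) (extChartAt 𝓘(ℝ, E) p).target :=
    (contMDiffOn_extChartAt_symm p).prodMk contMDiffOn_const
  refine (h1.comp h2 ?_).congr ?_
  · intro y hy
    rw [mem_preimage, Trivialization.mem_target]
    simpa using symm_mem_source hy
  · intro y hy
    have hb : (extChartAt 𝓘(ℝ, E) p).symm y ∈
        (trivializationAt E (TangentSpace 𝓘(ℝ, E) (M := M)) p).baseSet := by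
      simpa using symm_mem_source hy
    rw [Function.comp_apply, ← Trivialization.mk_symm _ hb u, ofChart,
      Trivialization.symmL_apply _ hb]

variable [RiemannianBundle (fun x : M ↦ TangentSpace 𝓘(ℝ, E) x)]

lemma chartMetric_apply (p : M) (y u v : E) : chartMetric p y u v =
    inner ℝ (ofChart p ((extChartAt 𝓘(ℝ, E) p).symm y) u)
      (ofChart p ((extChartAt 𝓘(ℝ, E) p).symm y) v) := rfl

lemma chartMetric_toChart {p x : M} (hp : x ∈ (chartAt E p).source)
    (v w : TangentSpace 𝓘(ℝ, E) x) :
    chartMetric p (extChartAt 𝓘(ℝ, E) p x) (toChart p x v) (toChart p x w) = inner ℝ v w := by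
  have hx : (extChartAt 𝓘(ℝ, E) p).symm (extChartAt 𝓘(ℝ, E) p x) = x :=
    PartialEquiv.left_inv _ (by rwa [extChartAt_source])
  rw [chartMetric_apply, hx, ofChart_toChart hp, ofChart_toChart hp]

lemma chartMetric_transition {p q : M} {y : E} (hy : y ∈ transitionSource E p q) (u v : E) :
    chartMetric p y u v = chartMetric q (transition E p q y)
      (fderiv ℝ (transition E p q) y u) (fderiv ℝ (transition E p q) y v) := by
  obtain ⟨hy1, hy2⟩ := mem_transitionSource.1 hy
  rw [fderiv_transition_eq hy, fderiv_transition_eq hy, transition, Function.comp_apply,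
    chartMetric_toChart hy2, chartMetric_apply]

variable [IsContMDiffRiemannianBundle 𝓘(ℝ, E) ∞ E (fun x : M ↦ TangentSpace 𝓘(ℝ, E) x)]
  [FiniteDimensional ℝ E]

lemma isMetricOn_chartMetric (p : M) :
    IsMetricOn (chartMetric p) (extChartAt 𝓘(ℝ, E) p).target where
  isOpen := isOpen_extChartAt_target p
  contDiffOn := by
    rw [contDiffOn_clm_apply]
    intro u
    rw [contDiffOn_clm_apply]
    intro v
    rw [← contMDiffOn_iff_contDiffOn]
    exact ContMDiffOn.inner_bundle (E := fun x : M ↦ TangentSpace 𝓘(ℝ, E) x)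
      (contMDiffOn_ofChart p u) (contMDiffOn_ofChart p v)
  symm y _ u v := by rw [chartMetric_apply, chartMetric_apply, real_inner_comm]
  pos y hy u hu := by
    rw [chartMetric_apply, real_inner_self_eq_norm_sq]
    have : ofChart p ((extChartAt 𝓘(ℝ, E) p).symm y) u ≠ 0 := by
      intro h
      apply hu
      rw [← toChart_ofChart (symm_mem_source hy) u, h, map_zero]
    positivity

lemma isMetricOn_chartMetric_transitionSource (p q : M) :
    IsMetricOn (chartMetric p) (transitionSource E p q) where
  isOpen := isOpen_transitionSource p q
  contDiffOn := (isMetricOn_chartMetric p).contDiffOn.mono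
    fun _ hy ↦ (mem_transitionSource.1 hy).1
  symm y hy := (isMetricOn_chartMetric p).symm y (mem_transitionSource.1 hy).1
  pos y hy := (isMetricOn_chartMetric p).pos y (mem_transitionSource.1 hy).1

/-- The curvature operator can be computed in any chart. -/
lemma toChart_curvature {p x : M} (hp : x ∈ (chartAt E p).source)
    (u v w : TangentSpace 𝓘(ℝ, E) x) :
    toChart p x (curvature x u v w) =
      coordCurvature (chartMetric p) (extChartAt 𝓘(ℝ, E) p x)
        (toChart p x u) (toChart p x v) (toChart p x w) := by
  have hx : x ∈ (chartAt E x).source := mem_chart_source E x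
  have key := fderiv_coordCurvature (isMetricOn_chartMetric_transitionSource x p)
    (isMetricOn_chartMetric p) (contDiffOn_transition x p) (mapsTo_transition x p)
    (fun y hy u v ↦ chartMetric_transition hy u v)
    (fun y hy ↦ surjective_fderiv_transition hy) (extChartAt_mem_transitionSource hx hp)
    (toChart x x u) (toChart x x v) (toChart x x w)
  rw [transition_extChartAt hx, fderiv_transition_toChart hx hp, fderiv_transition_toChart hx hp,
    fderiv_transition_toChart hx hp] at key
  rw [← key, curvature, ← fderiv_transition_toChart hx hp, toChart_ofChart hx]

/-- The equation of a parallel field along a curve does not depend on the chart. -/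
lemma parallel_change_chart {c : ℝ → M} {V : ∀ t, TangentSpace 𝓘(ℝ, E) (c t)} {s : Set ℝ} {t : ℝ}
    {v : TangentSpace 𝓘(ℝ, E) (c t)} (hc : ContinuousWithinAt c s t) {p q : M}
    (hp : c t ∈ (chartAt E p).source) (hq : c t ∈ (chartAt E q).source) (ht : t ∈ s)
    (hx : HasDerivWithinAt (fun τ ↦ extChartAt 𝓘(ℝ, E) p (c τ)) (toChart p (c t) v) s t)
    (hV : HasDerivWithinAt (fun τ ↦ toChart p (c τ) (V τ))
      (-christoffel (chartMetric p) (extChartAt 𝓘(ℝ, E) p (c t)) (toChart p (c t) v)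
        (toChart p (c t) (V t))) s t) :
    HasDerivWithinAt (fun τ ↦ toChart q (c τ) (V τ))
      (-christoffel (chartMetric q) (extChartAt 𝓘(ℝ, E) q (c t)) (toChart q (c t) v)
        (toChart q (c t) (V t))) s t := by
  have hy := extChartAt_mem_transitionSource hp hq
  have key := hasDerivWithinAt_parallel_map (isMetricOn_chartMetric_transitionSource p q)
    (isMetricOn_chartMetric q) (contDiffOn_transition p q) (mapsTo_transition p q)
    (fun y hy u v ↦ chartMetric_transition hy u v) hy (surjective_fderiv_transition hy) hx hV
  rw [transition_extChartAt hp, fderiv_transition_toChart hp hq,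
    fderiv_transition_toChart hp hq] at key
  refine key.congr_of_eventuallyEq_of_mem ?_ ht
  filter_upwards [hc ((chartAt E p).open_source.mem_nhds hp),
    hc ((chartAt E q).open_source.mem_nhds hq)] with τ h1 h2
  exact (fderiv_transition_toChart h1 h2 _).symm

end Charts

/-! ### Variations of geodesics, parallel translation and speed -/

section Linearization

variable {E : Type*} [NormedAddCommGroup E] [NormedSpace ℝ E]

/-- The parameter domain `(-ε, ε) × [0, 1]` of a variation. -/
def variationDomain (ε : ℝ) : Set (ℝ × ℝ) := Ioo (-ε) ε ×ˢ Icc (0 : ℝ) 1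

lemma uniqueDiffOn_variationDomain (ε : ℝ) : UniqueDiffOn ℝ (variationDomain ε) :=
  (uniqueDiffOn_Ioo (-ε) ε).prod (uniqueDiffOn_Icc zero_lt_one)

lemma mem_closure_interior_variationDomain {ε : ℝ} {z : ℝ × ℝ} (hz : z ∈ variationDomain ε) :
    z ∈ closure (interior (variationDomain ε)) := by
  have : (-ε : ℝ) ≠ ε := (hz.1.1.trans hz.1.2).ne
  rw [variationDomain, interior_prod_eq, closure_prod_eq, interior_Ioo, interior_Icc,
    closure_Ioo this, closure_Ioo zero_ne_one]
  exact ⟨Ioo_subset_Icc_self hz.1, hz.2⟩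

lemma hasDerivWithinAt_slice {F : Type*} [NormedAddCommGroup F] [NormedSpace ℝ F]
    {f : ℝ × ℝ → F} {f' : ℝ × ℝ →L[ℝ] F} {ε s t : ℝ} (hs : s ∈ Ioo (-ε) ε)
    (hf : HasFDerivWithinAt f f' (variationDomain ε) (s, t)) :
    HasDerivWithinAt (fun τ ↦ f (s, τ)) (f' (0, 1)) (Icc 0 1) t :=
  hf.comp_hasDerivWithinAt t ((hasDerivWithinAt_const t _ s).prodMk (hasDerivWithinAt_id t _))
    fun _ hτ ↦ ⟨hs, hτ⟩

lemma hasDerivAt_slice {F : Type*} [NormedAddCommGroup F] [NormedSpace ℝ F]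
    {f : ℝ × ℝ → F} {f' : ℝ × ℝ →L[ℝ] F} {ε s t : ℝ} (hs : s ∈ Ioo (-ε) ε)
    (ht : t ∈ Icc (0 : ℝ) 1) (hf : HasFDerivWithinAt f f' (variationDomain ε) (s, t)) :
    HasDerivAt (fun τ ↦ f (τ, t)) (f' (1, 0)) s := by
  refine HasDerivWithinAt.hasDerivAt (s := Ioo (-ε) ε) ?_ (isOpen_Ioo.mem_nhds hs)
  exact hf.comp_hasDerivWithinAt s
    ((hasDerivWithinAt_id s _).prodMk (hasDerivWithinAt_const s _ t)) fun _ hτ ↦ mk_mem_prod hτ ht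

lemma unique_hasDerivWithinAt_Icc {F : Type*} [NormedAddCommGroup F] [NormedSpace ℝ F]
    {f : ℝ → F} {a b : F} {t : ℝ} (ht : t ∈ Icc (0 : ℝ) 1)
    (ha : HasDerivWithinAt f a (Icc 0 1) t) (hb : HasDerivWithinAt f b (Icc 0 1) t) : a = b :=
  (uniqueDiffOn_Icc zero_lt_one t ht).eq_deriv _ ha hb

/-- The variation field of a family of solutions of the geodesic equation solves the linearized
geodesic equation. -/
lemma exists_linearized_geodesic {Γ : E → E →L[ℝ] E →L[ℝ] E} {U : Set E} {X : ℝ × ℝ → E}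
    {ε : ℝ} (hε : 0 < ε) (hX : ContDiffOn ℝ ∞ X (variationDomain ε))
    (hXU : ∀ t ∈ Icc (0 : ℝ) 1, X (0, t) ∈ U)
    (hΓ : ∀ y ∈ U, DifferentiableAt ℝ Γ y)
    (hsymm : ∀ y ∈ U, ∀ a b, Γ y a b = Γ y b a)
    (hgeo : ∀ z ∈ variationDomain ε,
      fderivWithin ℝ (fderivWithin ℝ X (variationDomain ε)) (variationDomain ε) z (0, 1) (0, 1) =
        -Γ (X z) (fderivWithin ℝ X (variationDomain ε) z (0, 1))
          (fderivWithin ℝ X (variationDomain ε) z (0, 1))) :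
    ∃ J' : ℝ → E, ∀ t ∈ Icc (0 : ℝ) 1,
      HasDerivWithinAt (fun τ ↦ fderivWithin ℝ X (variationDomain ε) (0, τ) (1, 0)) (J' t)
        (Icc 0 1) t ∧
      HasDerivWithinAt J' (-fderiv ℝ Γ (X (0, t))
          (fderivWithin ℝ X (variationDomain ε) (0, t) (1, 0))
          (fderivWithin ℝ X (variationDomain ε) (0, t) (0, 1))
          (fderivWithin ℝ X (variationDomain ε) (0, t) (0, 1))
        - (2 : ℝ) • Γ (X (0, t)) (fderivWithin ℝ X (variationDomain ε) (0, t) (0, 1)) (J' t))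
        (Icc 0 1) t := by
  set Ω := variationDomain ε with hΩ
  have hu : UniqueDiffOn ℝ Ω := uniqueDiffOn_variationDomain ε
  set D := fderivWithin ℝ X Ω with hD
  have hDs : ContDiffOn ℝ ∞ D Ω := hX.fderivWithin hu (by simp)
  set D2 := fderivWithin ℝ D Ω with hD2
  have hD2s : ContDiffOn ℝ ∞ D2 Ω := hDs.fderivWithin hu (by simp)
  set D3 := fderivWithin ℝ D2 Ω with hD3
  have d1 : ∀ z ∈ Ω, HasFDerivWithinAt X (D z) Ω z := fun z hz ↦
    ((hX z hz).differentiableWithinAt (by simp)).hasFDerivWithinAt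
  have d2 : ∀ z ∈ Ω, HasFDerivWithinAt D (D2 z) Ω z := fun z hz ↦
    ((hDs z hz).differentiableWithinAt (by simp)).hasFDerivWithinAt
  have d3 : ∀ z ∈ Ω, HasFDerivWithinAt D2 (D3 z) Ω z := fun z hz ↦
    ((hD2s z hz).differentiableWithinAt (by simp)).hasFDerivWithinAt
  have s2 : ∀ z ∈ Ω, ∀ a b, D2 z a b = D2 z b a := fun z hz ↦
    ((hX z hz).isSymmSndFDerivWithinAt two_le_infty hu
      (mem_closure_interior_variationDomain hz) hz).eq
  have s3 : ∀ z ∈ Ω, ∀ a b, D3 z a b = D3 z b a := fun z hz ↦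
    ((hDs z hz).isSymmSndFDerivWithinAt two_le_infty hu
      (mem_closure_interior_variationDomain hz) hz).eq
  have h0 : (0 : ℝ) ∈ Ioo (-ε) ε := ⟨by linarith, hε⟩
  refine ⟨fun t ↦ D2 (0, t) (1, 0) (0, 1), fun t ht ↦ ?_⟩
  have hz : ((0 : ℝ), t) ∈ Ω := ⟨h0, ht⟩
  constructor
  · have := (hasDerivWithinAt_slice h0 (d2 _ hz)).clm_apply
      (hasDerivWithinAt_const t _ ((1 : ℝ), (0 : ℝ)))
    refine this.congr_deriv ?_
    rw [map_zero, add_zero, s2 _ hz]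
  · have h1 := ((hasDerivWithinAt_slice h0 (d3 _ hz)).clm_apply
      (hasDerivWithinAt_const t _ ((1 : ℝ), (0 : ℝ)))).clm_apply
      (hasDerivWithinAt_const t _ ((0 : ℝ), (1 : ℝ)))
    refine h1.congr_deriv ?_
    -- the derivative of the geodesic equation in the direction of the variation
    have l := ((d3 _ hz).clm_apply (hasFDerivWithinAt_const ((0 : ℝ), (1 : ℝ)) (0, t) Ω)).clm_apply
      (hasFDerivWithinAt_const ((0 : ℝ), (1 : ℝ)) (0, t) Ω)
    have v := (d2 _ hz).clm_apply (hasFDerivWithinAt_const ((0 : ℝ), (1 : ℝ)) (0, t) Ω)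
    have r := ((((hΓ _ (hXU t ht)).hasFDerivAt.comp_hasFDerivWithinAt _
      (d1 _ hz)).clm_apply v).clm_apply v).neg
    have r' := r.congr hgeo (hgeo _ hz)
    have key := congr($((hu _ hz).eq l r') (1, 0))
    simp only [ContinuousLinearMap.comp_zero, zero_add, add_apply, neg_apply,
      ContinuousLinearMap.comp_apply, ContinuousLinearMap.flip_apply, Function.comp_apply] at key
    simp only [map_zero, add_zero, s3 _ hz (0, 1) (1, 0)]
    rw [key, hsymm _ (hXU t ht) (D2 (0, t) (1, 0) (0, 1))]
    module

end Linearization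

section Curves

variable {E : Type*} [NormedAddCommGroup E] [NormedSpace ℝ E]
  {M : Type*} [TopologicalSpace M] [ChartedSpace E M] [IsManifold 𝓘(ℝ, E) ∞ M]

omit [IsManifold 𝓘(ℝ, E) ∞ M] in
lemma mdifferentiableWithinAt_of_contMDiffOn {c : ℝ → M}
    (hc : ContMDiffOn 𝓘(ℝ, ℝ) 𝓘(ℝ, E) ∞ c (Icc 0 1)) {t : ℝ} (ht : t ∈ Icc (0 : ℝ) 1) :
    MDifferentiableWithinAt 𝓘(ℝ, ℝ) 𝓘(ℝ, E) c (Icc 0 1) t :=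
  (hc t ht).mdifferentiableWithinAt (by simp)

lemma hasDerivWithinAt_extChartAt_velocity {c : ℝ → M}
    (hc : ContMDiffOn 𝓘(ℝ, ℝ) 𝓘(ℝ, E) ∞ c (Icc 0 1)) {t : ℝ} (ht : t ∈ Icc (0 : ℝ) 1) {p : M}
    (hp : c t ∈ (chartAt E p).source) :
    HasDerivWithinAt (fun τ ↦ extChartAt 𝓘(ℝ, E) p (c τ))
      (toChart p (c t) (velocity (E := E) c t)) (Icc 0 1) t :=
  hasDerivWithinAt_extChartAt (mdifferentiableWithinAt_of_contMDiffOn hc ht) hp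

omit [IsManifold 𝓘(ℝ, E) ∞ M] in
lemma extChartAt_mem_target {p x : M} (hp : x ∈ (chartAt E p).source) :
    extChartAt 𝓘(ℝ, E) p x ∈ (extChartAt 𝓘(ℝ, E) p).target :=
  (extChartAt 𝓘(ℝ, E) p).map_source (by rwa [extChartAt_source])

variable [RiemannianBundle (fun x : M ↦ TangentSpace 𝓘(ℝ, E) x)]
  [IsContMDiffRiemannianBundle 𝓘(ℝ, E) ∞ E (fun x : M ↦ TangentSpace 𝓘(ℝ, E) x)]
  [FiniteDimensional ℝ E]

/-- Parallel translation to the initial point is given, in a chart containing the curve, by the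
inverse propagator of the equation of parallel fields. -/
lemma toChart_parallelTranslate {c : ℝ → M} {p : M} {P Q : ℝ → E →L[ℝ] E}
    (hc : ContMDiffOn 𝓘(ℝ, ℝ) 𝓘(ℝ, E) ∞ c (Icc 0 1))
    (hp : ∀ t ∈ Icc (0 : ℝ) 1, c t ∈ (chartAt E p).source) (hQ0 : Q 0 = 1)
    (hP : ∀ t ∈ Icc (0 : ℝ) 1, HasDerivWithinAt P
      (-(christoffelCLM (chartMetric p) (extChartAt 𝓘(ℝ, E) p (c t))
        (toChart p (c t) (velocity c t)) ∘L P t)) (Icc 0 1) t)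
    (hQ : ∀ t ∈ Icc (0 : ℝ) 1, HasDerivWithinAt Q
      (Q t ∘L christoffelCLM (chartMetric p) (extChartAt 𝓘(ℝ, E) p (c t))
        (toChart p (c t) (velocity c t))) (Icc 0 1) t)
    (hPQ : ∀ t ∈ Icc (0 : ℝ) 1, ∀ e, P t (Q t e) = e)
    {t : ℝ} (ht : t ∈ Icc (0 : ℝ) 1) (w : TangentSpace 𝓘(ℝ, E) (c t)) :
    toChart p (c 0) (parallelTranslate c t w) = Q t (toChart p (c t) w) := by
  have hex : ∃ V : ∀ τ, TangentSpace 𝓘(ℝ, E) (c τ), IsParallel c V ∧ V t = w := by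
    refine ⟨fun τ ↦ ofChart p (c τ) (P τ (Q t (toChart p (c t) w))), ?_, ?_⟩
    · intro τ hτ q hq
      refine parallel_change_chart (hc τ hτ).continuousWithinAt (hp τ hτ) hq hτ
        (hasDerivWithinAt_extChartAt_velocity hc hτ (hp τ hτ)) ?_
      rw [toChart_ofChart (hp τ hτ)]
      have h1 := (hP τ hτ).clm_apply (hasDerivWithinAt_const τ _ (Q t (toChart p (c t) w)))
      rw [map_zero, add_zero] at h1
      exact h1.congr_of_mem (fun s hs ↦ toChart_ofChart (hp s hs) _) hτ
    · simp only [hPQ t ht]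
      exact ofChart_toChart (hp t ht) w
  rw [parallelTranslate, dif_pos hex]
  obtain ⟨hV, hVt⟩ := hex.choose_spec
  set V := hex.choose
  have hconst : ∀ τ ∈ Icc (0 : ℝ) 1,
      HasDerivWithinAt (fun τ ↦ Q τ (toChart p (c τ) (V τ))) 0 (Icc 0 1) τ := by
    intro τ hτ
    refine ((hQ τ hτ).clm_apply (hV τ hτ p (hp τ hτ))).congr_deriv ?_
    simp
  have := eq_of_hasDerivWithinAt_zero hconst ht
  rw [hVt, hQ0] at this
  exact this.symm

/-- The speed of a geodesic contained in a chart is constant. -/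
lemma norm_velocity_eq {c : ℝ → M} {p : M} (hc : IsGeodesic E c)
    (hp : ∀ t ∈ Icc (0 : ℝ) 1, c t ∈ (chartAt E p).source) {t : ℝ} (ht : t ∈ Icc (0 : ℝ) 1) :
    ‖velocity (E := E) c t‖ = ‖velocity (E := E) c 0‖ := by
  have h0 : (0 : ℝ) ∈ Icc (0 : ℝ) 1 := by simp
  have key := eq_of_hasDerivWithinAt_zero (fun τ hτ ↦
    (isMetricOn_chartMetric p).hasDerivWithinAt_parallel (extChartAt_mem_target (hp τ hτ))
      (hasDerivWithinAt_extChartAt_velocity hc.1 hτ (hp τ hτ)) (hc.2 τ hτ p (hp τ hτ))) ht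
  rw [chartMetric_toChart (hp t ht), chartMetric_toChart (hp 0 h0), real_inner_self_eq_norm_sq,
    real_inner_self_eq_norm_sq] at key
  exact (sq_eq_sq₀ (norm_nonneg _) (norm_nonneg _)).1 key

lemma pathELength_eq_enorm_velocity {c : ℝ → M} {p : M} (hc : IsGeodesic E c)
    (hp : ∀ t ∈ Icc (0 : ℝ) 1, c t ∈ (chartAt E p).source) :
    pathELength 𝓘(ℝ, E) c 0 1 = ‖velocity (E := E) c 0‖ₑ := by
  rw [pathELength_eq_lintegral_mfderivWithin_Icc]
  rw [MeasureTheory.setLIntegral_congr_fun (g := fun _ ↦ ‖velocity (E := E) c 0‖ₑ)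
    measurableSet_Icc]
  · simp
  · intro t ht
    have := norm_velocity_eq hc hp ht
    change ‖velocity (E := E) c t‖ₑ = _
    rw [← ofReal_norm, this, ofReal_norm]

omit [FiniteDimensional ℝ E] in
variable (E M) in
lemma isContinuousRiemannianBundle_of_smooth :
    IsContinuousRiemannianBundle E (fun x : M ↦ TangentSpace 𝓘(ℝ, E) x) := by
  obtain ⟨g, hg, hi⟩ := IsContMDiffRiemannianBundle.exists_contMDiff (IB := 𝓘(ℝ, E))
    (n := (∞ : WithTop ℕ∞)) (F := E) (E := fun x : M ↦ TangentSpace 𝓘(ℝ, E) x)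
  exact ⟨g, hg.continuous, hi⟩

omit [FiniteDimensional ℝ E] in
/-- A short curve that starts close to `p` stays close to `p`. -/
lemma exists_nhds_forall_mem_of_pathELength_lt [RegularSpace M] (p : M) {N : Set M}
    (hN : N ∈ 𝓝 p) :
    ∃ W ∈ 𝓝 p, ∃ ρ > (0 : ℝ≥0∞), ∀ c : ℝ → M,
      ContMDiffOn 𝓘(ℝ, ℝ) 𝓘(ℝ, E) ∞ c (Icc 0 1) → c 0 ∈ W → pathELength 𝓘(ℝ, E) c 0 1 < ρ →
      ∀ t ∈ Icc (0 : ℝ) 1, c t ∈ N := by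
  have := isContinuousRiemannianBundle_of_smooth E M
  obtain ⟨r, hr, hsub⟩ := setOfPred_riemannianEDist_lt_subset_nhds' 𝓘(ℝ, E) hN
  have hr2 : 0 < r / 2 := ENNReal.half_pos hr.ne'
  refine ⟨_, eventually_riemannianEDist_lt 𝓘(ℝ, E) p hr2, r / 2, hr2, ?_⟩
  intro c hc hc0 hl t ht
  apply hsub
  have h1 : riemannianEDist 𝓘(ℝ, E) (c 0) (c t) ≤ pathELength 𝓘(ℝ, E) c 0 t :=
    riemannianEDist_le_pathELength
      ((hc.mono (Icc_subset_Icc le_rfl ht.2)).of_le (by simp)) rfl rfl ht.1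
  have h2 := h1.trans (pathELength_mono le_rfl ht.2)
  calc riemannianEDist 𝓘(ℝ, E) p (c t)
      ≤ riemannianEDist 𝓘(ℝ, E) p (c 0) + riemannianEDist 𝓘(ℝ, E) (c 0) (c t) :=
        riemannianEDist_triangle
    _ < r / 2 + r / 2 := ENNReal.add_lt_add hc0 (h2.trans_lt hl)
    _ = r := ENNReal.add_halves r

/-- In a chart containing the geodesic, a tangent field solves the linearized geodesic equation. -/
lemma exists_linearized_geodesic_of_isTangentField {c : ℝ → M}
    {ψ : ∀ t, TangentSpace 𝓘(ℝ, E) (c t)} {p : M} (hc : IsGeodesic E c)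
    (hp : ∀ t ∈ Icc (0 : ℝ) 1, c t ∈ (chartAt E p).source) (hψ : IsTangentField c ψ) :
    ∃ J' : ℝ → E, ∀ t ∈ Icc (0 : ℝ) 1,
      HasDerivWithinAt (fun τ ↦ toChart p (c τ) (ψ τ)) (J' t) (Icc 0 1) t ∧
      HasDerivWithinAt J' (-fderiv ℝ (christoffelCLM (chartMetric p)) (extChartAt 𝓘(ℝ, E) p (c t))
          (toChart p (c t) (ψ t)) (toChart p (c t) (velocity c t)) (toChart p (c t) (velocity c t))
        - (2 : ℝ) • christoffelCLM (chartMetric p) (extChartAt 𝓘(ℝ, E) p (c t))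
          (toChart p (c t) (velocity c t)) (J' t)) (Icc 0 1) t := by
  obtain ⟨ε₀, hε₀, H, hH, hHgeo, hHψ⟩ := hψ
  have hH0 : ∀ t ∈ Icc (0 : ℝ) 1, H (0, t) = c t := fun t ht ↦
    (congrArg TotalSpace.proj (hHψ t ht)).symm
  -- by compactness, the geodesics `H (s, ·)` with `s` small stay in the chart
  have htube : ∀ᶠ s in 𝓝 (0 : ℝ), ∀ t ∈ Icc (0 : ℝ) 1,
      (s, t) ∈ Ioo (-ε₀) ε₀ ×ˢ Icc (0 : ℝ) 1 → H (s, t) ∈ (chartAt E p).source := by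
    refine isCompact_Icc.eventually_forall_of_forall_eventually fun t ht ↦ ?_
    have h1 := (hH (0, t) ⟨⟨by linarith, hε₀⟩, ht⟩).continuousWithinAt
    have h2 : (chartAt E p).source ∈ 𝓝 (H (0, t)) :=
      (chartAt E p).open_source.mem_nhds (by rw [hH0 t ht]; exact hp t ht)
    exact eventually_nhdsWithin_iff.1 (h1 h2)
  obtain ⟨ε₁, hε₁, htube⟩ := Metric.eventually_nhds_iff.1 htube
  set ε := min ε₀ ε₁ with hεdef
  have hε : 0 < ε := lt_min hε₀ hε₁
  have hIoo : Ioo (-ε) ε ⊆ Ioo (-ε₀) ε₀ :=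
    Ioo_subset_Ioo (neg_le_neg (min_le_left _ _)) (min_le_left _ _)
  have hmem : ∀ z ∈ variationDomain ε, H z ∈ (chartAt E p).source := by
    rintro ⟨s, t⟩ ⟨hs, ht⟩
    refine htube ?_ t ht ⟨hIoo hs, ht⟩
    rw [Real.dist_eq, sub_zero, abs_lt]
    exact ⟨(neg_le_neg (min_le_right _ _)).trans_lt hs.1, hs.2.trans_le (min_le_right _ _)⟩
  have hHs : ContMDiffOn 𝓘(ℝ, ℝ × ℝ) 𝓘(ℝ, E) ∞ H (variationDomain ε) :=
    hH.mono (prod_mono hIoo le_rfl)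
  set X : ℝ × ℝ → E := fun z ↦ extChartAt 𝓘(ℝ, E) p (H z) with hXdef
  have hX : ContDiffOn ℝ ∞ X (variationDomain ε) := by
    rw [← contMDiffOn_iff_contDiffOn]
    exact (contMDiffOn_extChartAt (I := 𝓘(ℝ, E)) (n := ∞) (x := p)).comp hHs hmem
  have hXd : ∀ z ∈ variationDomain ε, HasFDerivWithinAt X
      (fderivWithin ℝ X (variationDomain ε) z) (variationDomain ε) z := fun z hz ↦
    ((hX z hz).differentiableWithinAt (by simp)).hasFDerivWithinAt
  have hDd : ∀ z ∈ variationDomain ε, HasFDerivWithinAt (fderivWithin ℝ X (variationDomain ε))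
      (fderivWithin ℝ (fderivWithin ℝ X (variationDomain ε)) (variationDomain ε) z)
      (variationDomain ε) z := fun z hz ↦
    (((hX.fderivWithin (uniqueDiffOn_variationDomain ε) (m := ∞) (by simp)) z
      hz).differentiableWithinAt (by simp)).hasFDerivWithinAt
  have hg := isMetricOn_chartMetric (E := E) p
  have h0 : (0 : ℝ) ∈ Ioo (-ε) ε := ⟨by linarith, hε⟩
  have hvel : ∀ s ∈ Ioo (-ε) ε, ∀ t ∈ Icc (0 : ℝ) 1,
      toChart p (H (s, t)) (velocity (E := E) (fun τ ↦ H (s, τ)) t)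
        = fderivWithin ℝ X (variationDomain ε) (s, t) (0, 1) := by
    intro s hs t ht
    exact unique_hasDerivWithinAt_Icc ht
      (hasDerivWithinAt_extChartAt_velocity (hHgeo s (hIoo hs)).1 ht (hmem (s, t) ⟨hs, ht⟩))
      (hasDerivWithinAt_slice hs (hXd _ ⟨hs, ht⟩))
  have hgeo : ∀ z ∈ variationDomain ε,
      fderivWithin ℝ (fderivWithin ℝ X (variationDomain ε)) (variationDomain ε) z (0, 1) (0, 1) =
        -christoffelCLM (chartMetric p) (X z) (fderivWithin ℝ X (variationDomain ε) z (0, 1))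
          (fderivWithin ℝ X (variationDomain ε) z (0, 1)) := by
    rintro ⟨s, t⟩ ⟨hs, ht⟩
    have h1 := (hHgeo s (hIoo hs)).2 t ht p (hmem (s, t) ⟨hs, ht⟩)
    rw [hvel s hs t ht] at h1
    have h2 := h1.congr_of_mem (fun τ hτ ↦ (hvel s hs τ hτ).symm) ht
    have h3 := (hasDerivWithinAt_slice hs (hDd (s, t) ⟨hs, ht⟩)).clm_apply
      (hasDerivWithinAt_const t _ ((0 : ℝ), (1 : ℝ)))
    rw [map_zero, add_zero] at h3
    exact unique_hasDerivWithinAt_Icc ht h3 h2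
  obtain ⟨J', hJ'⟩ := exists_linearized_geodesic hε hX
    (fun t ht ↦ extChartAt_mem_target (hmem (0, t) ⟨h0, ht⟩))
    (fun y hy ↦ (hg.hasFDerivAt_christoffelCLM hy).differentiableAt)
    (fun y hy a b ↦ hg.christoffel_symm hy a b) hgeo
  have hψX : ∀ t ∈ Icc (0 : ℝ) 1,
      toChart p (c t) (ψ t) = fderivWithin ℝ X (variationDomain ε) (0, t) (1, 0) := by
    intro t ht
    have h1 := congrArg (fun z : TangentBundle 𝓘(ℝ, E) M ↦ toChart p z.1 z.2) (hHψ t ht)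
    refine h1.trans ?_
    have h2 : MDifferentiableWithinAt 𝓘(ℝ, ℝ) 𝓘(ℝ, E) (fun s ↦ H (s, t)) univ 0 := by
      have h4 : ContMDiffOn 𝓘(ℝ, ℝ) 𝓘(ℝ, ℝ × ℝ) ∞ (fun s : ℝ ↦ (s, t)) (Ioo (-ε) ε) :=
        (contDiff_id.prodMk contDiff_const).contDiffOn.contMDiffOn
      have h5 := (hHs.comp h4 fun s hs ↦ mk_mem_prod hs ht).contMDiffAt (isOpen_Ioo.mem_nhds h0)
      exact (h5.mdifferentiableAt (by simp)).mdifferentiableWithinAt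
    have h3 := hasDerivWithinAt_extChartAt h2 (hmem (0, t) ⟨h0, ht⟩)
    rw [mfderivWithin_univ, hasDerivWithinAt_univ] at h3
    exact h3.unique (hasDerivAt_slice h0 ht (hXd (0, t) ⟨h0, ht⟩))
  have hcX : ∀ t ∈ Icc (0 : ℝ) 1, X (0, t) = extChartAt 𝓘(ℝ, E) p (c t) := fun t ht ↦ by
    rw [hXdef, ← hH0 t ht]
  have hcv : ∀ t ∈ Icc (0 : ℝ) 1, toChart p (c t) (velocity c t)
      = fderivWithin ℝ X (variationDomain ε) (0, t) (0, 1) := by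
    intro t ht
    refine unique_hasDerivWithinAt_Icc ht
      (hasDerivWithinAt_extChartAt_velocity hc.1 ht (hp t ht)) ?_
    exact (hasDerivWithinAt_slice h0 (hXd _ ⟨h0, ht⟩)).congr_of_mem
      (fun τ hτ ↦ (hcX τ hτ).symm) ht
  refine ⟨J', fun t ht ↦ ?_⟩
  obtain ⟨k1, k2⟩ := hJ' t ht
  rw [hcX t ht, ← hcv t ht, ← hψX t ht] at k2
  exact ⟨k1.congr_of_mem (fun τ hτ ↦ hψX τ hτ) ht, k2⟩

end Curves

/-! ### The expansion near a point -/

section LocalExpansion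

variable {E : Type*} [NormedAddCommGroup E] [NormedSpace ℝ E]
  {M : Type*} [TopologicalSpace M] [ChartedSpace E M] [IsManifold 𝓘(ℝ, E) ∞ M]
  [RiemannianBundle (fun x : M ↦ TangentSpace 𝓘(ℝ, E) x)]

/-- The difference between the two sides of the expansion at time `t` of the tangent field `ψ`
along `c`, up to third order. -/
def expansionError (c : ℝ → M) (ψ : ∀ t, TangentSpace 𝓘(ℝ, E) (c t)) (t : ℝ) :
    TangentSpace 𝓘(ℝ, E) (c 0) :=
  parallelTranslate c t (ψ t) -
    (t • parallelTranslate c 1 (ψ 1) + (1 - t) • ψ 0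
      + ((t ^ 3 - t) / 6) • curvature (c 0)
          (velocity c 0) (parallelTranslate c 1 (ψ 1)) (velocity c 0)
      - ((t ^ 3 - 3 * t ^ 2 + 2 * t) / 6) • curvature (c 0) (velocity c 0) (ψ 0) (velocity c 0))

variable [IsContMDiffRiemannianBundle 𝓘(ℝ, E) ∞ E (fun x : M ↦ TangentSpace 𝓘(ℝ, E) x)]
  [FiniteDimensional ℝ E]

set_option synthInstance.maxHeartbeats 200000 in
/-- Bounds for the geometry near `p`, in the chart centred at `p`: `A` bounds the Christoffel
symbols, the curvature and its derivative, and `K` compares the Riemannian norms with the norm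
of `E`. -/
lemma exists_local_bounds (p : M) : ∃ A K : ℝ, 1 ≤ A ∧ 0 < K ∧ ∀ᶠ x in 𝓝 p,
    x ∈ (chartAt E p).source ∧
    ‖christoffelCLM (chartMetric p) (extChartAt 𝓘(ℝ, E) p x)‖ ≤ A ∧
    ‖curvatureCLM (christoffelCLM (chartMetric p)) (extChartAt 𝓘(ℝ, E) p x)‖ ≤ A ∧
    ‖fderiv ℝ (curvatureCLM (christoffelCLM (chartMetric p))) (extChartAt 𝓘(ℝ, E) p x)‖ ≤ A ∧
    (∀ v : TangentSpace 𝓘(ℝ, E) x, ‖toChart p x v‖ ≤ K * ‖v‖) ∧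
    ∀ e : E, ‖ofChart p x e‖ ≤ K * ‖e‖ := by
  have := isContinuousRiemannianBundle_of_smooth E M
  obtain ⟨K₁, hK₁, h1⟩ := eventually_norm_trivializationAt_lt E
    (fun x : M ↦ TangentSpace 𝓘(ℝ, E) x) p
  obtain ⟨K₂, hK₂, h2⟩ := eventually_norm_symmL_trivializationAt_lt E
    (fun x : M ↦ TangentSpace 𝓘(ℝ, E) x) p
  have hg := isMetricOn_chartMetric (E := E) p
  have hy : extChartAt 𝓘(ℝ, E) p p ∈ (extChartAt 𝓘(ℝ, E) p).target := mem_extChartAt_target p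
  have hR := contDiffOn_curvatureCLM hg.isOpen hg.contDiffOn_christoffelCLM
  have hR' : ContDiffOn ℝ ∞ _ _ := hR.fderiv_of_isOpen hg.isOpen (by simp)
  have hnhds := hg.isOpen.mem_nhds hy
  have bound {F : Type _} [NormedAddCommGroup F] {f : E → F}
      (hf : ContinuousAt f (extChartAt 𝓘(ℝ, E) p p)) :
      ∃ B : ℝ, ∀ᶠ x in 𝓝 p, ‖f (extChartAt 𝓘(ℝ, E) p x)‖ < B :=
    ⟨_, ((hf.comp (continuousAt_extChartAt p)).norm).eventually_lt_const (lt_add_one _)⟩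
  obtain ⟨B₁, b1⟩ := bound (hg.contDiffAt_christoffelCLM hy).continuousAt
  obtain ⟨B₂, b2⟩ := bound (hR.contDiffAt hnhds).continuousAt
  obtain ⟨B₃, b3⟩ := bound (hR'.contDiffAt hnhds).continuousAt
  refine ⟨max 1 (max B₁ (max B₂ B₃)), max K₁ K₂, le_max_left _ _, lt_max_of_lt_left hK₁, ?_⟩
  filter_upwards [chart_source_mem_nhds E p, b1, b2, b3, h1, h2] with x hx hb1 hb2 hb3 hx1 hx2
  refine ⟨hx, hb1.le.trans (by simp), hb2.le.trans (by simp), hb3.le.trans (by simp),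
    fun v ↦ ?_, fun e ↦ ?_⟩
  · exact (ContinuousLinearMap.le_opNorm (E := TangentSpace 𝓘(ℝ, E) x) (F := E)
      (toChart p x) v).trans
      (mul_le_mul_of_nonneg_right (hx1.le.trans (le_max_left _ _)) (norm_nonneg _))
  · exact (ContinuousLinearMap.le_opNorm (E := E) (F := TangentSpace 𝓘(ℝ, E) x)
      (ofChart p x) e).trans
      (mul_le_mul_of_nonneg_right (hx2.le.trans (le_max_right _ _)) (norm_nonneg _))

/-- The coordinate estimate for a Jacobi field, translated back to the manifold. -/
lemma norm_expansionError_le_of_bounds {p : M} {A K d : ℝ} (hA : 1 ≤ A) (hK : 0 < K) {c : ℝ → M}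
    {ψ : ∀ t, TangentSpace 𝓘(ℝ, E) (c t)} (hc : IsGeodesic E c) (hψ : IsTangentField c ψ)
    (hb : ∀ t ∈ Icc (0 : ℝ) 1, c t ∈ (chartAt E p).source ∧
      ‖christoffelCLM (chartMetric p) (extChartAt 𝓘(ℝ, E) p (c t))‖ ≤ A ∧
      ‖curvatureCLM (christoffelCLM (chartMetric p)) (extChartAt 𝓘(ℝ, E) p (c t))‖ ≤ A ∧
      ‖fderiv ℝ (curvatureCLM (christoffelCLM (chartMetric p)))
        (extChartAt 𝓘(ℝ, E) p (c t))‖ ≤ A ∧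
      (∀ v : TangentSpace 𝓘(ℝ, E) (c t), ‖toChart p (c t) v‖ ≤ K * ‖v‖) ∧
      ∀ e : E, ‖ofChart p (c t) e‖ ≤ K * ‖e‖)
    (hd : ‖velocity (E := E) c 0‖ = d) (hAd : A * (K * d) ≤ 1 / 32)
    {t : ℝ} (ht : t ∈ Icc (0 : ℝ) 1) :
    ‖expansionError c ψ t‖ ≤ 224 * A ^ 2 * K ^ 5 * d ^ 3 * max ‖ψ 0‖ ‖ψ 1‖ := by
  have h0 : (0 : ℝ) ∈ Icc (0 : ℝ) 1 := by simp
  have h1 : (1 : ℝ) ∈ Icc (0 : ℝ) 1 := by simp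
  have hd0 : 0 ≤ d := hd ▸ norm_nonneg _
  have hp : ∀ t ∈ Icc (0 : ℝ) 1, c t ∈ (chartAt E p).source := fun t ht ↦ (hb t ht).1
  have hg := isMetricOn_chartMetric (E := E) p
  set g := chartMetric (E := E) p with hgdef
  set x : ℝ → E := fun t ↦ extChartAt 𝓘(ℝ, E) p (c t) with hx
  set v : ℝ → E := fun t ↦ toChart p (c t) (velocity (E := E) c t) with hv
  set J : ℝ → E := fun t ↦ toChart p (c t) (ψ t) with hJ
  have hxU : ∀ t ∈ Icc (0 : ℝ) 1, x t ∈ (extChartAt 𝓘(ℝ, E) p).target := fun t ht ↦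
    extChartAt_mem_target (hp t ht)
  have hx' : ∀ t ∈ Icc (0 : ℝ) 1, HasDerivWithinAt x (v t) (Icc 0 1) t := fun t ht ↦
    hasDerivWithinAt_extChartAt_velocity hc.1 ht (hp t ht)
  have hv' : ∀ t ∈ Icc (0 : ℝ) 1,
      HasDerivWithinAt v (-christoffelCLM g (x t) (v t) (v t)) (Icc 0 1) t := fun t ht ↦
    hc.2 t ht p (hp t ht)
  have hvη : ∀ t ∈ Icc (0 : ℝ) 1, ‖v t‖ ≤ K * d := by
    intro t ht
    have := (hb t ht).2.2.2.2.1 (velocity (E := E) c t)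
    rwa [norm_velocity_eq hc hp ht, hd] at this
  obtain ⟨J', hJ'⟩ := exists_linearized_geodesic_of_isTangentField hc hp hψ
  have hΓcont : ContinuousOn (fun t ↦ christoffelCLM g (x t) (v t)) (Icc 0 1) :=
    (hg.contDiffOn_christoffelCLM.continuousOn.comp
      (fun t ht ↦ (hx' t ht).continuousWithinAt) hxU).clm_apply
        fun t ht ↦ (hv' t ht).continuousWithinAt
  have hΓv : ∀ t ∈ Icc (0 : ℝ) 1, ‖christoffelCLM g (x t) (v t)‖ ≤ A * (K * d) := fun t ht ↦
    ((christoffelCLM g (x t)).le_opNorm (v t)).trans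
      (mul_le_mul (hb t ht).2.1 (hvη t ht) (norm_nonneg _) (by linarith))
  obtain ⟨P, Q, hP0, hQ0, hP, hQ, hP1, hQ1, hQP, hPQ⟩ :=
    exists_propagator (hAd.trans (by norm_num)) hΓcont hΓv
  have hR := contDiffOn_curvatureCLM hg.isOpen hg.contDiffOn_christoffelCLM
  have main := norm_jacobi_sub_cubic_le hA hAd
    (fun t ht ↦ (hg.hasFDerivAt_christoffelCLM (hxU t ht)).differentiableAt)
    (fun t ht ↦ (hR.contDiffAt (hg.isOpen.mem_nhds (hxU t ht))).differentiableAt (by simp))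
    (fun t ht ↦ by
      filter_upwards [hg.isOpen.mem_nhds (hxU t ht)] with y hy a b
      exact hg.christoffel_symm hy a b)
    (fun t ht ↦ (hb t ht).2.1) (fun t ht ↦ (hb t ht).2.2.1) (fun t ht ↦ (hb t ht).2.2.2.1)
    hvη hx' hv' (fun t ht ↦ (hJ' t ht).1) (fun t ht ↦ (hJ' t ht).2) hQ hP1 hQ1 hPQ ht
  have hpt (t : ℝ) (ht : t ∈ Icc (0 : ℝ) 1) :
      toChart p (c 0) (parallelTranslate c t (ψ t)) = Q t (J t) :=
    toChart_parallelTranslate hc.1 hp hQ0 hP hQ hPQ ht (ψ t)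
  have hcurv (w : TangentSpace 𝓘(ℝ, E) (c 0)) :
      toChart p (c 0) (curvature (c 0) (velocity c 0) w (velocity c 0))
        = curvatureCLM (christoffelCLM g) (x 0) (v 0) (toChart p (c 0) w) (v 0) := by
    rw [toChart_curvature (hp 0 h0), hg.coordCurvature_eq (hxU 0 h0)]
  have hQ0J : Q 0 (J 0) = toChart p (c 0) (ψ 0) := by rw [hQ0]; rfl
  have herr : toChart p (c 0) (expansionError c ψ t) =
      Q t (J t) - (t • Q 1 (J 1) + (1 - t) • Q 0 (J 0)
      + ((t ^ 3 - t) / 6) • curvatureCLM (christoffelCLM g) (x 0) (v 0) (Q 1 (J 1)) (v 0)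
      - ((t ^ 3 - 3 * t ^ 2 + 2 * t) / 6) •
        curvatureCLM (christoffelCLM g) (x 0) (v 0) (Q 0 (J 0)) (v 0)) := by
    rw [expansionError, map_sub, map_sub, map_add, map_add, map_smul, map_smul, map_smul, map_smul,
      hcurv, hcurv, hpt t ht, hpt 1 h1, hQ0J]
  rw [← herr] at main
  have hmax : max ‖Q 0 (J 0)‖ ‖Q 1 (J 1)‖ ≤ 2 * K * max ‖ψ 0‖ ‖ψ 1‖ := by
    refine max_le ?_ ?_
    · rw [hQ0J]
      have e1 := (hb 0 h0).2.2.2.2.1 (ψ 0)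
      have e2 : K * ‖ψ 0‖ ≤ K * max ‖ψ 0‖ ‖ψ 1‖ := by gcongr; exact le_max_left _ _
      have e3 : 0 ≤ K * ‖ψ 0‖ := by positivity
      linarith
    · have e1 := (hb 1 h1).2.2.2.2.1 (ψ 1)
      have e2 : K * ‖ψ 1‖ ≤ K * max ‖ψ 0‖ ‖ψ 1‖ := by gcongr; exact le_max_right _ _
      have e3 : ‖Q 1 (J 1)‖ ≤ 2 * ‖J 1‖ := by
        have e4 : Q 1 (J 1) = (Q 1 - 1) (J 1) + J 1 := by simp
        have e5 := ((Q 1 - 1).le_opNorm (J 1)).trans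
          (mul_le_mul_of_nonneg_right (hQ1 1 h1) (norm_nonneg _))
        have e6 := norm_add_le ((Q 1 - 1) (J 1)) (J 1)
        rw [← e4] at e6
        nlinarith [norm_nonneg (J 1)]
      linarith
  calc ‖expansionError c ψ t‖
      = ‖ofChart p (c 0) (toChart p (c 0) (expansionError c ψ t))‖ := by
        rw [ofChart_toChart (hp 0 h0)]
    _ ≤ K * ‖toChart p (c 0) (expansionError c ψ t)‖ := (hb 0 h0).2.2.2.2.2 _
    -- the factors `K` come from the norm of the error, from the speed and from the boundary values
    _ ≤ K * (112 * A ^ 2 * (K * d) ^ 3 * (2 * K * max ‖ψ 0‖ ‖ψ 1‖)) := by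
        gcongr
        exact main.trans (by gcongr)
    _ = 224 * A ^ 2 * K ^ 5 * d ^ 3 * max ‖ψ 0‖ ‖ψ 1‖ := by ring

/-- The expansion holds uniformly for short geodesics starting near a given point. -/
lemma exists_nhds_norm_expansionError_le [RegularSpace M] (p : M) :
    ∃ W ∈ 𝓝 p, ∃ C > (0 : ℝ), ∃ δ > (0 : ℝ),
      ∀ (c : ℝ → M) (ψ : ∀ t, TangentSpace 𝓘(ℝ, E) (c t)), c 0 ∈ W → IsGeodesic E c →
        IsTangentField c ψ → ∀ d : ℝ, 0 ≤ d → pathELength 𝓘(ℝ, E) c 0 1 = ENNReal.ofReal d →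
        d ≤ δ → ∀ t ∈ Icc (0 : ℝ) 1,
          ‖expansionError c ψ t‖ ≤ C * d ^ 3 * max ‖ψ 0‖ ‖ψ 1‖ := by
  obtain ⟨A, K, hA, hK, hN⟩ := exists_local_bounds (E := E) p
  obtain ⟨W, hW, ρ, hρ, hconf⟩ := exists_nhds_forall_mem_of_pathELength_lt (E := E) p hN
  obtain ⟨δ', hδ'0, hδ'⟩ := ENNReal.lt_iff_exists_real_btwn.1 hρ
  have hδ'1 : 0 < δ' := by
    by_contra h
    simp [ENNReal.ofReal_of_nonpos (not_lt.1 h)] at hδ'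
  refine ⟨W, hW, 224 * A ^ 2 * K ^ 5, by positivity, min δ' (1 / (32 * A * K)),
    lt_min hδ'1 (by positivity), ?_⟩
  intro c ψ hc0 hc hψ d hd hlen hdδ t ht
  have hb := hconf c hc.1 hc0 (by
    rw [hlen]
    exact (ENNReal.ofReal_le_ofReal (hdδ.trans (min_le_left _ _))).trans_lt hδ'.2)
  refine norm_expansionError_le_of_bounds hA hK hc hψ hb ?_ ?_ ht
  · rw [pathELength_eq_enorm_velocity hc (fun t ht ↦ (hb t ht).1), ← ofReal_norm,
      ENNReal.ofReal_eq_ofReal_iff (norm_nonneg _) hd] at hlen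
    exact hlen
  · have h2 := hdδ.trans (min_le_right _ _)
    rw [le_div_iff₀ (by positivity)] at h2
    linarith

omit [IsContMDiffRiemannianBundle 𝓘(ℝ, E) ∞ E (fun x : M ↦ TangentSpace 𝓘(ℝ, E) x)]
  [FiniteDimensional ℝ E] in
/-- A short geodesic is minimizing: the radii in the definition of the injectivity radius include
one that exceeds its length. -/
lemma pathELength_eq_of_isShortGeodesic {c : ℝ → M} (hc : IsShortGeodesic E c) :
    pathELength 𝓘(ℝ, E) c 0 1 = ENNReal.ofReal (riemannianEDist 𝓘(ℝ, E) (c 0) (c 1)).toReal := by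
  obtain ⟨r, hr, hlt⟩ := lt_sSup_iff.1 hc.2
  have := (hr c hc.1 hlt).1
  rw [← this, ENNReal.ofReal_toReal hlt.ne_top]

end LocalExpansion

end ShortGeodesic

end

theorem mainTheorem2
    {E : Type*} [NormedAddCommGroup E] [NormedSpace ℝ E] [FiniteDimensional ℝ E]
    {M : Type*} [TopologicalSpace M] [T2Space M] [CompactSpace M]
    [ChartedSpace E M] [IsManifold 𝓘(ℝ, E) ∞ M]
    [RiemannianBundle (fun x : M ↦ TangentSpace 𝓘(ℝ, E) x)]
    [IsContMDiffRiemannianBundle 𝓘(ℝ, E) ∞ E (fun x : M ↦ TangentSpace 𝓘(ℝ, E) x)] :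
    ∃ C > (0 : ℝ), ∃ δ > (0 : ℝ),
      ∀ (σ : ℝ → M) (ψ : ∀ t, TangentSpace 𝓘(ℝ, E) (σ t)),
        ShortGeodesic.IsShortGeodesic E σ → ShortGeodesic.IsTangentField σ ψ →
        ∀ d : ℝ, d = (riemannianEDist 𝓘(ℝ, E) (σ 0) (σ 1)).toReal → d ≤ δ →
        ∀ t ∈ Icc (0 : ℝ) 1,
          ‖ShortGeodesic.parallelTranslate σ t (ψ t) -
            (t • ShortGeodesic.parallelTranslate σ 1 (ψ 1) + (1 - t) • ψ 0
              + ((t ^ 3 - t) / 6) • ShortGeodesic.curvature (σ 0)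
                  (ShortGeodesic.velocity σ 0) (ShortGeodesic.parallelTranslate σ 1 (ψ 1))
                  (ShortGeodesic.velocity σ 0)
              - ((t ^ 3 - 3 * t ^ 2 + 2 * t) / 6) • ShortGeodesic.curvature (σ 0)
                  (ShortGeodesic.velocity σ 0) (ψ 0) (ShortGeodesic.velocity σ 0))‖
            ≤ C * d ^ 3 * max ‖ψ 0‖ ‖ψ 1‖ := by
  -- by compactness, it suffices to treat the geodesics starting near a given point
  have key : ∃ C > (0 : ℝ), ∃ δ > (0 : ℝ),
      ∀ (σ : ℝ → M) (ψ : ∀ t, TangentSpace 𝓘(ℝ, E) (σ t)), σ 0 ∈ (univ : Set M) →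
        ShortGeodesic.IsGeodesic E σ → ShortGeodesic.IsTangentField σ ψ → ∀ d : ℝ, 0 ≤ d →
        pathELength 𝓘(ℝ, E) σ 0 1 = ENNReal.ofReal d → d ≤ δ → ∀ t ∈ Icc (0 : ℝ) 1,
          ‖ShortGeodesic.expansionError σ ψ t‖ ≤ C * d ^ 3 * max ‖ψ 0‖ ‖ψ 1‖ := by
    refine isCompact_univ.induction_on ?_ ?_ ?_ ?_
    · exact ⟨1, one_pos, 1, one_pos, fun σ ψ h ↦ absurd h (notMem_empty _)⟩
    · rintro S T hST ⟨C, hC, δ, hδ, h⟩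
      exact ⟨C, hC, δ, hδ, fun σ ψ hσ ↦ h σ ψ (hST hσ)⟩
    · rintro S T ⟨C₁, hC₁, δ₁, hδ₁, h₁⟩ ⟨C₂, hC₂, δ₂, hδ₂, h₂⟩
      refine ⟨max C₁ C₂, lt_max_of_lt_left hC₁, min δ₁ δ₂, lt_min hδ₁ hδ₂, ?_⟩
      rintro σ ψ (hσ | hσ) hgeo hψ d hd hlen hdδ t ht
      · refine (h₁ σ ψ hσ hgeo hψ d hd hlen (hdδ.trans (min_le_left _ _)) t ht).trans ?_
        gcongr
        exact le_max_left _ _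
      · refine (h₂ σ ψ hσ hgeo hψ d hd hlen (hdδ.trans (min_le_right _ _)) t ht).trans ?_
        gcongr
        exact le_max_right _ _
    · intro p _
      obtain ⟨W, hW, h⟩ := ShortGeodesic.exists_nhds_norm_expansionError_le (E := E) p
      exact ⟨W, mem_nhdsWithin_of_mem_nhds hW, h⟩
  obtain ⟨C, hC, δ, hδ, h⟩ := key
  refine ⟨C, hC, δ, hδ, fun σ ψ hσ hψ d hd hdδ t ht ↦ ?_⟩
  exact h σ ψ (mem_univ _) hσ.1 hψ d (hd ▸ ENNReal.toReal_nonneg)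
    (hd ▸ ShortGeodesic.pathELength_eq_of_isShortGeodesic hσ) hdδ t ht
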